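/- Let $Q=\prod_{j=1}^3[a_j,b_j]$ and $Q'=\prod_{j=1}^3[a'_j,b'_j]$ with $a_j\le b_j$, $a'_j\le b'_j$ be cuboids in $\mathbb R^3$, and let $n=(n_1,n_2,n_3)$, $m=(m_1,m_2,m_3)\in\mathbb N_0^3$. Write $x^n=x_1^{n_1}x_2^{n_2}x_3^{n_3}$, $y^m=y_1^{m_1}y_2^{m_2}y_3^{m_3}$, let $|\cdot|$ be the Euclidean norm, and consider the Newton potential and the force components $$V=\int_Q\int_{Q'}\frac{x^n y^m}{|x-y|}\,dy\,dx,\qquad F_j=\int_Q\int_{Q'}\frac{(x_j-y_j)\,x^n y^m}{|x-y|^{3}}\,dy\,dx\quad(j=1,2,3).$$ The integrands are absolutely integrable on $Q\times Q'$, and $V$, $F_1$, $F_2$, $F_3$ are each a linear combination of terms of the form $$\frac1{\rho_\delta},\qquad \operatorname{arctanh}\frac{\delta_3}{\rho_\delta},\qquad \arctan\frac{\delta_2\delta_3}{\delta_1\rho_\delta},\qquad \rho_\delta=\sqrt{\delta_1^2+\delta_2^2+\delta_3^2},$$ where $\delta=(\delta_1,\delta_2,\delta_3)$ satisfies $\delta_1\neq0$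 and is, up to a permutation of its components, the componentwise difference of a vertex of $Q$ and a vertex of $Q'$. The coefficients are rational polynomials in the integration bounds: for each pair of vertices (specified by the choice of lower or upper bound in each coordinate), each permutation and each of the three forms, the coefficient is the value at $(a,b,a',b')$ of a polynomial in twelve variables with rational coefficients. These polynomials depend only on $n$, $m$ and on which of the quantities $V,F_1,F_2,F_3$ is considered, not on the bounds; at given bounds, the sum extends over those vertex pairs and permutations for which $\delta_1\ne0$. -/

import Mathlib

open MeasureTheory

noncomputable section

namespace Cuboid

/-- `|x - y|`, the Euclidean distance in three-space, written out in coordinates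
(`Fin 3 → ℝ` itself carries the sup norm). -/
def dist3 (x y : Fin 3 → ℝ) : ℝ := Real.sqrt (∑ i, (x i - y i) ^ 2)

/-- The weight `x₁^{n₁} x₂^{n₂} x₃^{n₃} y₁^{m₁} y₂^{m₂} y₃^{m₃}`. -/
def weight (n m : Fin 3 → ℕ) (x y : Fin 3 → ℝ) : ℝ :=
  (∏ i, x i ^ n i) * ∏ i, y i ^ m i

/-- The integrand of the Newton potential. -/
def potentialKernel (n m : Fin 3 → ℕ) (x y : Fin 3 → ℝ) : ℝ :=
  weight n m x y / dist3 x y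

/-- The integrand of the `j`-th force component. -/
def forceKernel (n m : Fin 3 → ℕ) (j : Fin 3) (x y : Fin 3 → ℝ) : ℝ :=
  (x j - y j) * weight n m x y / dist3 x y ^ 3

/-- The integral of `K x y` for `x` in the cuboid `[a, b]` and `y` in the cuboid `[a', b']`.
For the product order, `Set.Icc a b` is `[a₁,b₁] × [a₂,b₂] × [a₃,b₃]`. -/
def doubleIntegral (K : (Fin 3 → ℝ) → (Fin 3 → ℝ) → ℝ) (a b a' b' : Fin 3 → ℝ) : ℝ :=
  ∫ x in Set.Icc a b, ∫ y in Set.Icc a' b', K x y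

/-- The Newton potential `V` of the cuboids `Q = [a, b]` and `Q' = [a', b']`. -/
def potential (n m : Fin 3 → ℕ) (a b a' b' : Fin 3 → ℝ) : ℝ :=
  doubleIntegral (potentialKernel n m) a b a' b'

/-- The force component `F_j` of the cuboids `Q = [a, b]` and `Q' = [a', b']`. -/
def force (n m : Fin 3 → ℕ) (j : Fin 3) (a b a' b' : Fin 3 → ℝ) : ℝ :=
  doubleIntegral (forceKernel n m j) a b a' b'

/-- The vertex of the cuboid `[a, b]` selected by `s`. -/
def vertex (a b : Fin 3 → ℝ) (s : Fin 3 → Bool) : Fin 3 → ℝ :=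
  fun i => if s i then b i else a i

/-- The difference of a vertex of `[a, b]` and a vertex of `[a', b']`, its components
permuted by `π`. The components `δ 0, δ 1, δ 2` are `δ₁, δ₂, δ₃`. -/
def delta (a b a' b' : Fin 3 → ℝ) (s s' : Fin 3 → Bool) (π : Equiv.Perm (Fin 3)) :
    Fin 3 → ℝ :=
  fun i => vertex a b s (π i) - vertex a' b' s' (π i)

/-- `ρ_δ`. -/
def rho (δ : Fin 3 → ℝ) : ℝ := Real.sqrt (δ 0 ^ 2 + δ 1 ^ 2 + δ 2 ^ 2)

/-- Names of the twelve integration bounds: those of `a`, `b`, `a'` and `b'`, in this order. -/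
abbrev BoundVar : Type := (Fin 3 ⊕ Fin 3) ⊕ (Fin 3 ⊕ Fin 3)

/-- The values of the twelve integration bounds. -/
def bounds (a b a' b' : Fin 3 → ℝ) : BoundVar → ℝ :=
  Sum.elim (Sum.elim a b) (Sum.elim a' b')

/-- For each pair of vertices and each permutation, a polynomial with rational coefficients
in the twelve integration bounds, taken as indeterminates. -/
abbrev Coeffs : Type :=
  (Fin 3 → Bool) → (Fin 3 → Bool) → Equiv.Perm (Fin 3) → MvPolynomial BoundVar ℚ

/-- The linear combination of the terms `1 / ρ_δ`, `artanh (δ₃ / ρ_δ)` and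
`arctan (δ₂ δ₃ / (δ₁ ρ_δ))` with coefficients `A`, `B`, `C` evaluated at the integration bounds,
extended over all permuted vertex differences `δ` that satisfy `δ₁ ≠ 0`. -/
def elementaryCombination (A B C : Coeffs) (a b a' b' : Fin 3 → ℝ) : ℝ :=
  ∑ s : Fin 3 → Bool, ∑ s' : Fin 3 → Bool, ∑ π : Equiv.Perm (Fin 3),
    let δ := delta a b a' b' s s' π
    let val : MvPolynomial BoundVar ℚ → ℝ := fun P => MvPolynomial.aeval (bounds a b a' b') P
    open Classical in
    if δ 0 ≠ 0 then
      val (A s s' π) * (1 / rho δ)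
        + val (B s s' π) * Real.artanh (δ 2 / rho δ)
        + val (C s s' π) * Real.arctan (δ 1 * δ 2 / (δ 0 * rho δ))
    else 0

end Cuboid

end

/-!
Integrating with respect to one coordinate after the other, the integral of `f` over a box is the
alternating sum over its corners of an iterated antiderivative `F` of `f`. The point is that for the
kernels `1 / ρ` and `z_k / ρ³` these antiderivatives stay elementary: from the third one on they lie
in the span, over the rational polynomials in the coordinates, of `ρ`, `z_i artanh (z_j / ρ)` and
`z_i arctan (z_j z_k / (z_i ρ))`. Integration by parts reduces this to integrands with the single
factor `1 / ρ` or `z_j / (ρ (z_i² + z_k²))`, where powers of the integration variable are lowered by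
means of `z_i² = ρ² - z_j² - z_k²` and `z_i² = (z_i² + z_k²) - z_k²`.

The terms of this span are continuous, as the logarithmic singularities of `artanh` are damped by
the factors `z_i`. Hence the inner integral, as a function of `x`, is again a combination of such
terms in `x - y` for the vertices `y` of `Q'`, and three more antiderivatives with respect to `x`
yield a sum over pairs of vertices. At a vertex difference `δ` the factors `δ_i` annihilate the
terms with `δ_i = 0`, and `ρ = ρ² / ρ = ∑ i, δ_i² / ρ` has coefficients of this kind, too.
-/

namespace Cuboid

open Function Set Topology
open scoped Pointwise

noncomputable section

section BoxIntegration

variable {n : ℕ}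

/-- The sign with which the corner of a box selected by `s` enters an iterated integral: `-1` to
the number of lower bounds. -/
def cornerSign (s : Fin n → Bool) : ℤ := ∏ i, if s i then 1 else -1

/-- The alternating sum of `F` over the corners of the box `[a, b]`, the `n`-dimensional analogue
of `F b - F a`. -/
def cornerSum (F : (Fin n → ℝ) → ℝ) (a b : Fin n → ℝ) : ℝ :=
  ∑ s : Fin n → Bool, (cornerSign s : ℝ) * F fun i => if s i then b i else a i

/-- The integral of `f` over a box is the corner sum of `F`. Boxes with a face in a
coordinate hyperplane are excluded, as the antiderivatives in use are only controlled away from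
these hyperplanes. -/
def IsCornerPrimitive (F f : (Fin n → ℝ) → ℝ) : Prop :=
  ∀ a b : Fin n → ℝ, a ≤ b → (∀ i, a i ≠ 0) → (∀ i, b i ≠ 0) →
    ∫ z in Icc a b, f z = cornerSum F a b

/-- Along the lines in direction `i` on which no other coordinate vanishes, `f` is interval
integrable with antiderivative `F`. -/
def IsLinePrimitive (i : Fin n) (F f : (Fin n → ℝ) → ℝ) : Prop :=
  ∀ z : Fin n → ℝ, (∀ l, l ≠ i → z l ≠ 0) → ∀ a b : ℝ,
    IntervalIntegrable (fun t => f (update z i t)) volume a b ∧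
      ∫ t in a..b, f (update z i t) = F (update z i b) - F (update z i a)

theorem cornerSign_insertNth (j : Fin (n + 1)) (c : Bool) (s : Fin n → Bool) :
    cornerSign (j.insertNth c s) = (if c then 1 else -1) * cornerSign s := by
  simp [cornerSign, Fin.prod_univ_succAbove _ j]

theorem cornerSum_eq_cornerSum_sub (j : Fin (n + 1)) (F : (Fin (n + 1) → ℝ) → ℝ)
    (a b : Fin (n + 1) → ℝ) :
    cornerSum F a b = cornerSum (fun y => F (j.insertNth (b j) y) - F (j.insertNth (a j) y))
      (j.removeNth a) (j.removeNth b) := by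
  have hcorner (c : Bool) (s : Fin n → Bool) :
      (fun i => if (j.insertNth c s : Fin (n + 1) → Bool) i then b i else a i) =
        j.insertNth (if c then b j else a j)
          fun i => if s i then j.removeNth b i else j.removeNth a i := by
    ext i
    cases i using j.succAboveCases <;> simp [Fin.removeNth]
  have hsign (c : Bool) (s : Fin n → Bool) :
      cornerSign (Fin.insertNthEquiv (fun _ => Bool) j (c, s)) =
        (if c then 1 else -1) * cornerSign s := cornerSign_insertNth j c s
  simp only [cornerSum]
  rw [← (Fin.insertNthEquiv (fun _ => Bool) j).sum_comp, Fintype.sum_prod_type]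
  simp only [hsign, Fin.insertNthEquiv_apply, hcorner, Fintype.sum_bool,
    ← Finset.sum_add_distrib]
  refine Finset.sum_congr rfl fun s _ => ?_
  simp only [↓reduceIte, one_mul, Bool.false_eq_true, Int.reduceNeg, neg_mul, Int.cast_neg]
  ring

theorem cornerSum_sub_left (F : (Fin n → ℝ) → ℝ) (x a b : Fin n → ℝ) :
    cornerSum F (x - b) (x - a) = (-1) ^ n * cornerSum (fun y => F (x - y)) a b := by
  have hsign (s : Fin n → Bool) : cornerSign (fun i => !s i) = (-1) ^ n * cornerSign s := by
    rw [cornerSign, cornerSign, ← Fin.prod_const, ← Finset.prod_mul_distrib]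
    refine Finset.prod_congr rfl fun i _ => ?_
    cases s i <;> simp
  rw [cornerSum, cornerSum, Finset.mul_sum,
    ← (Equiv.piCongrRight fun _ : Fin n => Equiv.boolNot).sum_comp]
  refine Finset.sum_congr rfl fun s _ => ?_
  have hcorner : (fun i => if !s i then (x - a) i else (x - b) i) =
      x - fun i => if s i then b i else a i := by
    ext i
    cases h : s i <;> simp [h]
  change (cornerSign fun i => !s i : ℝ) * F (fun i => if !s i then (x - a) i else (x - b) i) = _
  rw [hcorner, hsign]
  push_cast
  ring

theorem integral_Icc_eq_integral_insertNth (j : Fin (n + 1)) {f : (Fin (n + 1) → ℝ) → ℝ}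
    {a b : Fin (n + 1) → ℝ} (hab : a ≤ b) (hf : IntegrableOn f (Icc a b)) :
    ∫ z in Icc a b, f z =
      ∫ s in a j..b j, ∫ y in Icc (j.removeNth a) (j.removeNth b), f (j.insertNth s y) := by
  let e := (MeasurableEquiv.piFinSuccAbove (fun _ : Fin (n + 1) => ℝ) j).symm
  have he : MeasurePreserving e := (volume_preserving_piFinSuccAbove (fun _ => ℝ) j).symm
  have hpre : e ⁻¹' Icc a b = Icc (a j) (b j) ×ˢ Icc (j.removeNth a) (j.removeNth b) :=
    ((Fin.insertNthOrderIso (fun _ => ℝ) j).preimage_Icc _ _).trans (Icc_prod_eq _ _)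
  have hfe : IntegrableOn (fun p => f (e p)) (e ⁻¹' Icc a b) :=
    (he.integrableOn_comp_preimage e.measurableEmbedding).mpr hf
  rw [← he.setIntegral_preimage_emb e.measurableEmbedding, hpre, Measure.volume_eq_prod,
    setIntegral_prod _ (by rwa [hpre] at hfe), integral_Icc_eq_integral_Ioc,
    intervalIntegral.integral_of_le (hab j)]
  rfl

theorem IsLinePrimitive.insertNth {i : Fin n} {j : Fin (n + 1)} {F f : (Fin (n + 1) → ℝ) → ℝ}
    (h : IsLinePrimitive (j.succAbove i) F f) {s : ℝ} (hs : s ≠ 0) :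
    IsLinePrimitive i (fun y => F (j.insertNth s y)) fun y => f (j.insertNth s y) := by
  intro y hy a b
  simp only [Fin.insertNth_update]
  refine h _ (fun l hl => ?_) a b
  cases l using j.succAboveCases with
  | x => simpa using hs
  | p l => simpa using hy l fun h => hl (h ▸ rfl)

theorem isCornerPrimitive_self (f : (Fin 0 → ℝ) → ℝ) : IsCornerPrimitive f f := by
  intro a b hab _ _
  obtain rfl := Subsingleton.elim a b
  have hunique (g : (Fin 0 → ℝ) → ℝ) : g = fun _ => g a :=
    funext fun z => congrArg g (Subsingleton.elim z a)
  have hvol : volume.real (Icc a a) = 1 := by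
    rw [Measure.real, Real.volume_Icc_pi]
    simp
  rw [hunique f, setIntegral_const, hvol]
  simp [cornerSum, cornerSign]

theorem IsCornerPrimitive.of_slices (j : Fin (n + 1)) {F G f : (Fin (n + 1) → ℝ) → ℝ}
    (hf : LocallyIntegrable f)
    (hG : ∀ s : ℝ, s ≠ 0 →
      IsCornerPrimitive (fun y => G (j.insertNth s y)) fun y => f (j.insertNth s y))
    (hF : IsLinePrimitive j F G) : IsCornerPrimitive F f := by
  intro a b hab ha hb
  have hline (y : Fin n → ℝ) (hy : ∀ i, y i ≠ 0) :=
    hF (j.insertNth 0 y) (fun l hl => by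
      obtain ⟨l, rfl⟩ := Fin.exists_succAbove_eq hl
      simpa using hy l) (a j) (b j)
  simp only [Fin.update_insertNth] at hline
  have hcorner (s : Fin n → Bool) (i : Fin n) :
      (if s i then j.removeNth b i else j.removeNth a i) ≠ 0 := by
    cases s i
    · exact ha _
    · exact hb _
  calc ∫ z in Icc a b, f z
      = ∫ s in a j..b j, ∫ y in Icc (j.removeNth a) (j.removeNth b), f (j.insertNth s y) :=
        integral_Icc_eq_integral_insertNth j hab (hf.integrableOn_isCompact isCompact_Icc)
    _ = ∫ s in a j..b j,
          cornerSum (fun y => G (j.insertNth s y)) (j.removeNth a) (j.removeNth b) := by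
        refine intervalIntegral.integral_congr_ae ?_
        filter_upwards [compl_mem_ae_iff.mpr (measure_singleton (0 : ℝ))] with s hs _
        exact hG s hs _ _ (fun i => hab _) (fun i => ha _) fun i => hb _
    _ = cornerSum (fun y => ∫ s in a j..b j, G (j.insertNth s y))
          (j.removeNth a) (j.removeNth b) := by
        simp only [cornerSum]
        rw [intervalIntegral.integral_finsetSum fun s _ =>
          ((hline _ (hcorner s)).1.const_mul _)]
        simp only [intervalIntegral.integral_const_mul]
    _ = cornerSum F a b := by
        rw [cornerSum_eq_cornerSum_sub j]
        exact Finset.sum_congr rfl fun s _ => congrArg _ (hline _ (hcorner s)).2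

/-- Integration in the order `j.succAbove (p.succAbove 0)`, `j.succAbove p`, `j` of the
coordinates, the first one being innermost. -/
theorem isCornerPrimitive_of_isLinePrimitive (j : Fin 3) (p : Fin 2)
    {f f₁ f₂ f₃ : (Fin 3 → ℝ) → ℝ} (hf : LocallyIntegrable f)
    (hcont : ∀ z, z ≠ 0 → ContinuousAt f z)
    (h₁ : IsLinePrimitive (j.succAbove (p.succAbove 0)) f₁ f)
    (h₂ : IsLinePrimitive (j.succAbove p) f₂ f₁) (h₃ : IsLinePrimitive j f₃ f₂) :
    IsCornerPrimitive f₃ f := by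
  have hslice {s : ℝ} (hs : s ≠ 0) : Continuous fun y : Fin 2 → ℝ => f (j.insertNth s y) :=
    continuous_iff_continuousAt.mpr fun y =>
      (hcont _ fun h => hs (by simpa using congrFun h j)).comp (by fun_prop)
  refine .of_slices j hf (fun s hs => ?_) h₃
  refine .of_slices p (hslice hs).locallyIntegrable (fun t ht => ?_) (h₂.insertNth hs)
  exact .of_slices 0 (G := fun y => f (j.insertNth s (p.insertNth t y)))
    ((hslice hs).comp (by fun_prop)).locallyIntegrable
    (fun r _ => isCornerPrimitive_self _) ((h₁.insertNth hs).insertNth ht)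

/-- `F` has the partial derivative `f` with respect to the `i`-th coordinate off the coordinate
hyperplanes. -/
def IsPartialAntideriv (i : Fin n) (F f : (Fin n → ℝ) → ℝ) : Prop :=
  ∀ z : Fin n → ℝ, (∀ l, z l ≠ 0) → HasDerivAt (fun t => F (update z i t)) (f z) (z i)

/-- Continuity at the points with at most one vanishing coordinate. -/
def IsLineContinuous (f : (Fin n → ℝ) → ℝ) : Prop :=
  ∀ (i : Fin n) (z : Fin n → ℝ), (∀ l, l ≠ i → z l ≠ 0) → ContinuousAt f z

theorem IsLineContinuous.continuous_update {f : (Fin n → ℝ) → ℝ} (hf : IsLineContinuous f)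
    {i : Fin n} {z : Fin n → ℝ} (hz : ∀ l, l ≠ i → z l ≠ 0) :
    Continuous fun t => f (update z i t) :=
  continuous_iff_continuousAt.mpr fun t =>
    (hf i (update z i t) fun l hl => by rw [update_of_ne hl]; exact hz l hl).comp
      (continuous_const.update i continuous_id).continuousAt

theorem IsPartialAntideriv.isLinePrimitive {i : Fin n} {F f : (Fin n → ℝ) → ℝ}
    (h : IsPartialAntideriv i F f) (hF : IsLineContinuous F) (hf : IsLineContinuous f) :
    IsLinePrimitive i F f := by
  intro z hz a b
  have hint := (hf.continuous_update hz).intervalIntegrable a b (μ := volume)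
  refine ⟨hint, integral_eq_of_hasDerivAt_off_countable (fun t => F (update z i t)) _
    (countable_singleton 0) (hF.continuous_update hz).continuousOn (fun t ht => ?_) hint⟩
  have hgen (l : Fin n) : update z i t l ≠ 0 := by
    by_cases hl : l = i
    · subst hl
      simpa using ht.2
    · simpa [hl] using hz l hl
  simpa using h _ hgen

end BoxIntegration

/-! ### Calculus of the elementary terms -/

/-- The indices `i`, `j`, `k` are pairwise distinct, hence the three coordinate directions. -/
structure IsTriple (i j k : Fin 3) : Prop where
  ne_left : i ≠ j
  ne_right : j ≠ k
  ne_outer : i ≠ k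

theorem isTriple_iff {i j k : Fin 3} : IsTriple i j k ↔ i ≠ j ∧ j ≠ k ∧ i ≠ k :=
  ⟨fun h => ⟨h.1, h.2, h.3⟩, fun h => ⟨h.1, h.2.1, h.2.2⟩⟩

theorem IsTriple.swap {i j k : Fin 3} (h : IsTriple i j k) : IsTriple i k j :=
  ⟨h.ne_outer, h.ne_right.symm, h.ne_left⟩

theorem IsTriple.rotate {i j k : Fin 3} (h : IsTriple i j k) : IsTriple j k i :=
  ⟨h.ne_right, h.ne_outer.symm, h.ne_left.symm⟩

theorem exists_isTriple_of_ne {i j : Fin 3} (h : i ≠ j) : ∃ k, IsTriple i j k := by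
  simp only [isTriple_iff]
  revert i j
  decide

theorem exists_isTriple (i : Fin 3) : ∃ j k, IsTriple i j k := by
  simp only [isTriple_iff]
  revert i
  decide

theorem IsTriple.eq_or {i j k : Fin 3} (h : IsTriple i j k) (l : Fin 3) :
    l = i ∨ l = j ∨ l = k := by
  rw [isTriple_iff] at h
  revert i j k l
  decide

theorem IsTriple.exists_perm {i j k : Fin 3} (h : IsTriple i j k) :
    ∃ π : Equiv.Perm (Fin 3), π 0 = i ∧ π 1 = j ∧ π 2 = k := by
  rw [isTriple_iff] at h
  revert i j k
  decide

theorem rho_sq {i j k : Fin 3} (h : IsTriple i j k) (z : Fin 3 → ℝ) :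
    rho z ^ 2 = z i ^ 2 + z j ^ 2 + z k ^ 2 := by
  obtain ⟨π, rfl, rfl, rfl⟩ := h.exists_perm
  rw [rho, Real.sq_sqrt (by positivity), ← Fin.sum_univ_three (fun l => z l ^ 2),
    ← Fin.sum_univ_three (fun l => z (π l) ^ 2), Equiv.sum_comp π fun l => z l ^ 2]

theorem rho_nonneg (z : Fin 3 → ℝ) : 0 ≤ rho z := Real.sqrt_nonneg _

theorem rho_eq {i j k : Fin 3} (h : IsTriple i j k) (z : Fin 3 → ℝ) :
    rho z = Real.sqrt (z i ^ 2 + z j ^ 2 + z k ^ 2) := by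
  rw [← rho_sq h, Real.sqrt_sq (rho_nonneg z)]

theorem abs_le_rho (z : Fin 3 → ℝ) (i : Fin 3) : |z i| ≤ rho z := by
  obtain ⟨j, k, h⟩ := exists_isTriple i
  rw [rho_eq h]
  apply Real.abs_le_sqrt
  nlinarith [sq_nonneg (z j), sq_nonneg (z k)]

theorem norm_le_rho (z : Fin 3 → ℝ) : ‖z‖ ≤ rho z :=
  (pi_norm_le_iff_of_nonneg (rho_nonneg z)).mpr (abs_le_rho z)

theorem rho_pos {z : Fin 3 → ℝ} (hz : z ≠ 0) : 0 < rho z :=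
  (norm_pos_iff.mpr hz).trans_le (norm_le_rho z)

theorem rho_pos_of_apply_ne_zero {z : Fin 3 → ℝ} {i : Fin 3} (hi : z i ≠ 0) : 0 < rho z :=
  rho_pos fun h => hi (congrFun h i)

theorem rho_neg (z : Fin 3 → ℝ) : rho (-z) = rho z := by
  simp [rho]

theorem continuous_rho : Continuous rho := by
  unfold rho
  fun_prop

theorem sq_lt_rho_sq {z : Fin 3 → ℝ} {i j : Fin 3} (hij : i ≠ j) (hi : z i ≠ 0) :
    z j ^ 2 < rho z ^ 2 := by
  obtain ⟨k, h⟩ := exists_isTriple_of_ne hij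
  rw [rho_sq h]
  have : 0 < z i ^ 2 := by positivity
  nlinarith [sq_nonneg (z k)]

theorem div_rho_mem_Ioo {z : Fin 3 → ℝ} {i j : Fin 3} (hij : i ≠ j) (hi : z i ≠ 0) :
    z j / rho z ∈ Ioo (-1 : ℝ) 1 := by
  have hlt := abs_lt_of_sq_lt_sq (sq_lt_rho_sq hij hi) (rho_nonneg z)
  have hρ := rho_pos_of_apply_ne_zero hi
  rw [mem_Ioo, ← abs_lt, abs_div, abs_of_pos hρ]
  exact (div_lt_one hρ).mpr hlt

theorem hasDerivAt_artanh {x : ℝ} (hx : x ∈ Ioo (-1 : ℝ) 1) :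
    HasDerivAt Real.artanh (1 / (1 - x ^ 2)) x := by
  have h₁ : 0 < 1 + x := by linarith [hx.1]
  have h₂ : 0 < 1 - x := by linarith [hx.2]
  have hquot : HasDerivAt (fun t : ℝ => (1 + t) / (1 - t))
      ((1 * (1 - x) - (1 + x) * (-1)) / (1 - x) ^ 2) x :=
    ((hasDerivAt_id x).const_add 1).div ((hasDerivAt_id x).const_sub 1) h₂.ne'
  have hlog := (hquot.log (by positivity)).const_mul (1 / 2)
  have heq : Real.artanh =ᶠ[𝓝 x] fun t => 1 / 2 * Real.log ((1 + t) / (1 - t)) := by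
    filter_upwards [Ioo_mem_nhds hx.1 hx.2] with t ht
    exact Real.artanh_eq_half_log ⟨ht.1.le, ht.2.le⟩
  refine (hlog.congr_of_eventuallyEq heq).congr_deriv ?_
  have : 1 - x ^ 2 ≠ 0 := by nlinarith
  field_simp
  ring

/-- The term `artanh (z_j / ρ)`. -/
def artanhTerm (j : Fin 3) (z : Fin 3 → ℝ) : ℝ := Real.artanh (z j / rho z)

/-- The term `arctan (z_j z_k / (z_i ρ))`. -/
def arctanTerm (i j k : Fin 3) (z : Fin 3 → ℝ) : ℝ :=
  Real.arctan (z j * z k / (z i * rho z))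

/-- The function `z_j / (ρ r²)`, where `r² = ρ² - z_j²` is the squared distance to the `j`-axis. The
derivatives of `artanhTerm` and `arctanTerm` are composed of it. -/
def axialKernel (j : Fin 3) (z : Fin 3 → ℝ) : ℝ := z j / (rho z * (rho z ^ 2 - z j ^ 2))

theorem axialKernel_eq {i j k : Fin 3} (h : IsTriple i j k) (z : Fin 3 → ℝ) :
    axialKernel j z = z j / (rho z * (z i ^ 2 + z k ^ 2)) := by
  rw [axialKernel, rho_sq h]
  ring

theorem arctanTerm_comm (i j k : Fin 3) (z : Fin 3 → ℝ) :
    arctanTerm i j k z = arctanTerm i k j z := by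
  simp only [arctanTerm, mul_comm (z j)]

section Derivatives

variable {i j k : Fin 3}

theorem isPartialAntideriv_rho (i : Fin 3) : IsPartialAntideriv i rho fun z => z i / rho z := by
  intro z hz
  obtain ⟨j, k, h⟩ := exists_isTriple i
  have hslice : (fun t => rho (update z i t)) = fun t => Real.sqrt (t ^ 2 + z j ^ 2 + z k ^ 2) := by
    funext t
    rw [rho_eq h, update_self, update_of_ne h.ne_left.symm, update_of_ne h.ne_outer.symm]
  have hρ := rho_pos_of_apply_ne_zero (hz i)
  have hsq : z i ^ 2 + z j ^ 2 + z k ^ 2 ≠ 0 := by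
    rw [← rho_sq h]
    positivity
  rw [hslice]
  refine ((((hasDerivAt_pow 2 (z i)).add_const _).add_const _).sqrt hsq).congr_deriv ?_
  rw [← rho_eq h]
  field_simp
  norm_num

theorem isPartialAntideriv_inv_rho (i : Fin 3) :
    IsPartialAntideriv i (fun z => 1 / rho z) fun z => -(z i / rho z ^ 3) := by
  intro z hz
  have hρ := (rho_pos_of_apply_ne_zero (hz i)).ne'
  have h := (isPartialAntideriv_rho i z hz).fun_inv (by simpa using hρ)
  simp only [one_div]
  refine h.congr_deriv ?_
  rw [update_eq_self]
  field_simp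

theorem isPartialAntideriv_artanhTerm_self (i : Fin 3) :
    IsPartialAntideriv i (artanhTerm i) fun z => 1 / rho z := by
  intro z hz
  obtain ⟨j, k, h⟩ := exists_isTriple i
  have hρ := (rho_pos_of_apply_ne_zero (hz i)).ne'
  have hquot : HasDerivAt (fun t => update z i t i / rho (update z i t))
      ((1 * rho z - z i * (z i / rho z)) / rho z ^ 2) (z i) := by
    simpa using (hasDerivAt_id (z i)).fun_div (isPartialAntideriv_rho i z hz) (by simpa using hρ)
  have hmem := div_rho_mem_Ioo h.ne_left.symm (hz j)
  refine ((hasDerivAt_artanh (by simpa using hmem)).comp (z i) hquot).congr_deriv ?_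
  have : rho z ^ 2 - z i ^ 2 ≠ 0 := (sub_pos.mpr (sq_lt_rho_sq h.ne_left.symm (hz j))).ne'
  simp only [update_eq_self]
  field_simp

theorem isPartialAntideriv_artanhTerm_of_ne (hij : i ≠ j) :
    IsPartialAntideriv i (artanhTerm j) fun z => -(z i * axialKernel j z) := by
  intro z hz
  have hρ := (rho_pos_of_apply_ne_zero (hz i)).ne'
  have hquot : HasDerivAt (fun t => update z i t j / rho (update z i t))
      ((0 * rho z - z j * (z i / rho z)) / rho z ^ 2) (z i) := by
    simpa [update_of_ne hij.symm] using
      (hasDerivAt_const (z i) (z j)).fun_div (isPartialAntideriv_rho i z hz) (by simpa using hρ)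
  have hmem := div_rho_mem_Ioo hij (hz i)
  refine ((hasDerivAt_artanh (by simpa using hmem)).comp (z i) hquot).congr_deriv ?_
  have : rho z ^ 2 - z j ^ 2 ≠ 0 := (sub_pos.mpr (sq_lt_rho_sq hij (hz i))).ne'
  simp only [update_eq_self, axialKernel]
  field_simp
  ring

theorem isPartialAntideriv_arctanTerm_of_ne (h : IsTriple i j k) :
    IsPartialAntideriv i (arctanTerm k i j) fun z => z k * axialKernel j z := by
  intro z hz
  have hρ := (rho_pos_of_apply_ne_zero (hz i)).ne'
  have hquot : HasDerivAt (fun t => update z i t i * update z i t j /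
        (update z i t k * rho (update z i t)))
      ((z j * (z k * rho z) - z i * z j * (z k * (z i / rho z))) / (z k * rho z) ^ 2) (z i) := by
    simpa [update_of_ne h.ne_left.symm, update_of_ne h.ne_outer.symm] using
      ((hasDerivAt_id (z i)).mul_const (z j)).fun_div
        ((isPartialAntideriv_rho i z hz).const_mul (z k)) (by simpa using ⟨hz k, hρ⟩)
  refine HasDerivAt.congr_deriv hquot.arctan ?_
  have hi := hz i
  have hj := hz j
  have hk := hz k
  have hden : 1 + (z i * z j / (z k * rho z)) ^ 2 =
      (z i ^ 2 + z k ^ 2) * (z j ^ 2 + z k ^ 2) / (z k * rho z) ^ 2 := by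
    field_simp
    rw [rho_sq h]
    ring
  simp only [update_eq_self, axialKernel_eq h, hden]
  field_simp
  rw [rho_sq h]
  ring

theorem isPartialAntideriv_arctanTerm_self (h : IsTriple i j k) :
    IsPartialAntideriv i (arctanTerm i j k)
      fun z => -(z j * axialKernel k z + z k * axialKernel j z) := by
  intro z hz
  have hρ := (rho_pos_of_apply_ne_zero (hz i)).ne'
  have hquot : HasDerivAt (fun t => update z i t j * update z i t k /
        (update z i t i * rho (update z i t)))
      ((0 * (z i * rho z) - z j * z k * (1 * rho z + z i * (z i / rho z))) / (z i * rho z) ^ 2)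
      (z i) := by
    simpa [update_of_ne h.ne_left.symm, update_of_ne h.ne_outer.symm] using
      (hasDerivAt_const (z i) (z j * z k)).fun_div
        ((hasDerivAt_id (z i)).fun_mul (isPartialAntideriv_rho i z hz))
        (by simpa using ⟨hz i, hρ⟩)
  refine HasDerivAt.congr_deriv hquot.arctan ?_
  have hi := hz i
  have hj := hz j
  have hk := hz k
  have hden : 1 + (z j * z k / (z i * rho z)) ^ 2 =
      (z i ^ 2 + z j ^ 2) * (z i ^ 2 + z k ^ 2) / (z i * rho z) ^ 2 := by
    field_simp
    rw [rho_sq h]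
    ring
  simp only [update_eq_self, axialKernel_eq h, axialKernel_eq h.swap, hden]
  field_simp
  rw [rho_sq h]
  ring

end Derivatives

section Continuity

theorem continuousAt_artanhTerm {i j : Fin 3} (hij : i ≠ j) {z : Fin 3 → ℝ} (hi : z i ≠ 0) :
    ContinuousAt (artanhTerm j) z :=
  (hasDerivAt_artanh (div_rho_mem_Ioo hij hi)).continuousAt.comp
    (f := fun z : Fin 3 → ℝ => z j / rho z)
    ((continuous_apply j).continuousAt.div continuous_rho.continuousAt
      (rho_pos_of_apply_ne_zero hi).ne')

theorem continuousAt_arctanTerm {i : Fin 3} (j k : Fin 3) {z : Fin 3 → ℝ} (hi : z i ≠ 0) :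
    ContinuousAt (arctanTerm i j k) z :=
  Real.continuous_arctan.continuousAt.comp (f := fun z : Fin 3 → ℝ => z j * z k / (z i * rho z))
    (ContinuousAt.div (by fun_prop)
      ((continuous_apply i).continuousAt.mul continuous_rho.continuousAt)
      (mul_ne_zero hi (rho_pos_of_apply_ne_zero hi).ne'))

theorem half_log_le_two_mul_sqrt {u v : ℝ} (hu : 0 < u) (hv : 0 < v) (huv : u ≤ v ^ 2) :
    1 / 2 * Real.log u ≤ 2 * Real.sqrt v := by
  have hlog : Real.log u ≤ 4 * Real.log (Real.sqrt v) := by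
    calc Real.log u ≤ Real.log (v ^ 2) := Real.log_le_log hu huv
      _ = 4 * Real.log (Real.sqrt v) := by
        rw [Real.log_pow, Real.log_sqrt hv.le]
        push_cast
        ring
  have := Real.log_le_sub_one_of_pos (Real.sqrt_pos.mpr hv)
  linarith

theorem abs_artanh_le {x y : ℝ} (hx : x ∈ Ioo (-1 : ℝ) 1) (hy : 0 < y) (hxy : y ^ 2 ≤ 1 - x ^ 2) :
    |Real.artanh x| ≤ 2 * Real.sqrt (2 / y) := by
  have h₁ : 0 < 1 + x := by linarith [hx.1]
  have h₂ : 0 < 1 - x := by linarith [hx.2]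
  have hupper : (1 + x) / (1 - x) ≤ (2 / y) ^ 2 := by
    rw [div_pow, div_le_div_iff₀ h₂ (by positivity)]
    nlinarith [hx.1, hx.2]
  have hlower : ((1 + x) / (1 - x))⁻¹ ≤ (2 / y) ^ 2 := by
    rw [inv_div, div_pow, div_le_div_iff₀ h₁ (by positivity)]
    nlinarith [hx.1, hx.2]
  have hy' : 0 < 2 / y := by positivity
  have hneg := half_log_le_two_mul_sqrt (by positivity) hy' hlower
  rw [Real.log_inv] at hneg
  rw [Real.artanh_eq_half_log ⟨hx.1.le, hx.2.le⟩, abs_le]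
  exact ⟨by linarith, half_log_le_two_mul_sqrt (by positivity) hy' hupper⟩

theorem abs_mul_artanhTerm_le {i j : Fin 3} (hij : i ≠ j) (z : Fin 3 → ℝ) :
    |z i * artanhTerm j z| ≤ 2 * Real.sqrt (2 * rho z * |z i|) := by
  by_cases hi : z i = 0
  · simp [hi]
  have hρ := rho_pos_of_apply_ne_zero hi
  have hpos : 0 < |z i| := abs_pos.mpr hi
  obtain ⟨k, h⟩ := exists_isTriple_of_ne hij
  have hle : (|z i| / rho z) ^ 2 ≤ 1 - (z j / rho z) ^ 2 := by
    rw [div_pow, div_pow, sq_abs, le_sub_iff_add_le, ← add_div, div_le_one (by positivity),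
      rho_sq h]
    nlinarith [sq_nonneg (z k)]
  calc |z i * artanhTerm j z| = |z i| * |artanhTerm j z| := abs_mul _ _
    _ ≤ |z i| * (2 * Real.sqrt (2 / (|z i| / rho z))) := by
        gcongr
        exact abs_artanh_le (div_rho_mem_Ioo hij hi) (by positivity) hle
    _ = 2 * Real.sqrt (|z i| ^ 2 * (2 / (|z i| / rho z))) := by
        rw [Real.sqrt_mul (by positivity), Real.sqrt_sq hpos.le]
        ring
    _ = 2 * Real.sqrt (2 * rho z * |z i|) := by
        congr 2
        field_simp

theorem continuous_mul_artanhTerm {i j : Fin 3} (hij : i ≠ j) :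
    Continuous fun z : Fin 3 → ℝ => z i * artanhTerm j z := by
  rw [continuous_iff_continuousAt]
  intro z
  by_cases hi : z i = 0
  · have hz : z i * artanhTerm j z = 0 := by simp [hi]
    rw [ContinuousAt, hz]
    refine squeeze_zero_norm (abs_mul_artanhTerm_le hij) ?_
    have hbound : Continuous fun z : Fin 3 → ℝ => 2 * Real.sqrt (2 * rho z * |z i|) := by
      have := continuous_rho
      fun_prop
    simpa [hi] using hbound.tendsto z
  · exact (continuous_apply i).continuousAt.mul (continuousAt_artanhTerm hij hi)

theorem continuous_mul_arctanTerm (i j k : Fin 3) :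
    Continuous fun z : Fin 3 → ℝ => z i * arctanTerm i j k z := by
  rw [continuous_iff_continuousAt]
  intro z
  by_cases hi : z i = 0
  · have hz : z i * arctanTerm i j k z = 0 := by simp [hi]
    rw [ContinuousAt, hz]
    refine squeeze_zero_norm (a := fun z => |z i| * (Real.pi / 2)) (fun z => ?_) ?_
    · rw [Real.norm_eq_abs, abs_mul]
      gcongr
      exact abs_le.mpr ⟨(Real.neg_pi_div_two_lt_arctan _).le, (Real.arctan_lt_pi_div_two _).le⟩
    · have hbound : Continuous fun z : Fin 3 → ℝ => |z i| * (Real.pi / 2) := by fun_prop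
      simpa [hi] using hbound.tendsto z
  · exact (continuous_apply i).continuousAt.mul (continuousAt_arctanTerm j k hi)

end Continuity

/-! ### Polynomial spans and their antiderivatives -/

section PolySpan

variable {σ X : Type*} {c : σ → X → ℝ} {S : Set (X → ℝ)} {f : X → ℝ}

/-- The linear combinations of the functions in `S` whose coefficients are rational polynomials in
the coordinate functions `c`. It is considered as a `ℚ`-module, since taking antiderivatives
does not commute with coordinate factors. -/
def polySpan (c : σ → X → ℝ) (S : Set (X → ℝ)) : Submodule ℚ (X → ℝ) :=
  (Submodule.span (Algebra.adjoin ℚ (range c)) S).restrictScalars ℚ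

theorem subset_polySpan : S ⊆ polySpan c S := fun _ hf => Submodule.subset_span hf

theorem coord_mul_mem_polySpan (l : σ) (hf : f ∈ polySpan c S) :
    (fun x => c l x * f x) ∈ polySpan c S :=
  Submodule.smul_mem (Submodule.span (Algebra.adjoin ℚ (range c)) S)
    (⟨c l, Algebra.subset_adjoin (mem_range_self l)⟩ : Algebra.adjoin ℚ (range c)) hf

theorem coord_pow_mul_mem_polySpan (l : σ) (p : ℕ) (hf : f ∈ polySpan c S) :
    (fun x => c l x ^ p * f x) ∈ polySpan c S := by
  induction p with
  | zero => simpa using hf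
  | succ p ih =>
    convert coord_mul_mem_polySpan l ih using 2 with x
    ring

theorem polySpan_le {N : Submodule ℚ (X → ℝ)} (hS : S ⊆ N)
    (hc : ∀ (l : σ), ∀ f ∈ N, (fun x => c l x * f x) ∈ N) : polySpan c S ≤ N := by
  have hmul (a : X → ℝ) (ha : a ∈ Algebra.adjoin ℚ (range c)) : ∀ f ∈ N, a * f ∈ N := by
    induction ha using Algebra.adjoin_induction with
    | mem a ha =>
      obtain ⟨l, rfl⟩ := ha
      exact hc l
    | algebraMap q =>
      intro f hf
      simpa [Algebra.smul_def] using N.smul_mem q hf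
    | add a b _ _ ha hb =>
      intro f hf
      simpa only [add_mul] using add_mem (ha f hf) (hb f hf)
    | mul a b _ _ ha hb =>
      intro f hf
      simpa only [mul_assoc] using ha _ (hb f hf)
  intro f hf
  induction hf using Submodule.span_induction with
  | mem f hf => exact hS hf
  | zero => exact N.zero_mem
  | add f g _ _ hf hg => exact add_mem hf hg
  | smul a f _ hf => exact hmul a a.2 f hf

theorem polySpan_induction {p : (X → ℝ) → Prop} (mem : ∀ f ∈ S, p f) (zero : p 0)
    (add : ∀ f g, p f → p g → p (f + g)) (smul : ∀ (q : ℚ) f, p f → p (q • f))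
    (coord_mul : ∀ l f, p f → p fun x => c l x * f x) (hf : f ∈ polySpan c S) : p f :=
  let N : Submodule ℚ (X → ℝ) :=
    { carrier := {f | p f}
      add_mem' := add _ _
      zero_mem' := zero
      smul_mem' := smul }
  polySpan_le (N := N) mem coord_mul hf

theorem continuousAt_of_mem_polySpan [TopologicalSpace X] {x : X}
    (hc : ∀ l, ContinuousAt (c l) x) (hS : ∀ g ∈ S, ContinuousAt g x) (hf : f ∈ polySpan c S) :
    ContinuousAt f x := by
  refine polySpan_induction hS continuousAt_const (fun _ _ h h' => h.add h') (fun q f h => ?_)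
    (fun l _ h => (hc l).mul h) hf
  simpa only [Pi.smul_def, Rat.smul_def] using! continuousAt_const.mul h

theorem continuous_of_mem_polySpan [TopologicalSpace X] (hc : ∀ l, Continuous (c l))
    (hS : ∀ g ∈ S, Continuous g) (hf : f ∈ polySpan c S) : Continuous f :=
  continuous_iff_continuousAt.mpr fun _ => continuousAt_of_mem_polySpan
    (fun l => (hc l).continuousAt) (fun g hg => (hS g hg).continuousAt) hf

theorem polySpan_mono {T : Set (X → ℝ)} (h : S ⊆ T) : polySpan c S ≤ polySpan c T :=
  Submodule.span_mono h

end PolySpan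

section Primitive

variable {n : ℕ}

/-- The combinations of the functions in `S` with rational polynomials in the coordinates as
coefficients. -/
abbrev pointSpan (S : Set ((Fin n → ℝ) → ℝ)) : Submodule ℚ ((Fin n → ℝ) → ℝ) :=
  polySpan (fun i z => z i) S

/-- The functions with an antiderivative in `N` with respect to the `i`-th coordinate. -/
def primitive (i : Fin n) (N : Submodule ℚ ((Fin n → ℝ) → ℝ)) :
    Submodule ℚ ((Fin n → ℝ) → ℝ) where
  carrier := {f | ∃ F ∈ N, IsPartialAntideriv i F f}
  add_mem' := by
    rintro f g ⟨F, hF, h⟩ ⟨G, hG, h'⟩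
    exact ⟨F + G, add_mem hF hG, fun z hz => (h z hz).add (h' z hz)⟩
  zero_mem' := ⟨0, N.zero_mem, fun _ _ => hasDerivAt_const _ _⟩
  smul_mem' := by
    rintro c f ⟨F, hF, h⟩
    refine ⟨c • F, N.smul_mem c hF, fun z hz => ?_⟩
    simpa [Rat.smul_def] using (h z hz).const_mul (c : ℝ)

variable {i l : Fin n} {N : Submodule ℚ ((Fin n → ℝ) → ℝ)} {S T : Set ((Fin n → ℝ) → ℝ)}
  {f g F : (Fin n → ℝ) → ℝ}

theorem IsPartialAntideriv.coord_mul (hli : l ≠ i) (h : IsPartialAntideriv i F f) :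
    IsPartialAntideriv i (fun z => z l * F z) fun z => z l * f z := by
  intro z hz
  simpa [update_of_ne hli] using (h z hz).const_mul (z l)

theorem IsPartialAntideriv.pow_mul (p : ℕ) (h : IsPartialAntideriv i F f) :
    IsPartialAntideriv i (fun z => z i ^ p * F z)
      fun z => p * z i ^ (p - 1) * F z + z i ^ p * f z := by
  intro z hz
  simpa using (hasDerivAt_pow p (z i)).fun_mul (h z hz)

theorem primitive_mono {M : Submodule ℚ ((Fin n → ℝ) → ℝ)} (h : N ≤ M) :
    primitive i N ≤ primitive i M := fun _ ⟨F, hF, hd⟩ => ⟨F, h hF, hd⟩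

theorem primitive_congr (hf : f ∈ primitive i N) (h : ∀ z, (∀ l, z l ≠ 0) → g z = f z) :
    g ∈ primitive i N := by
  obtain ⟨F, hF, hd⟩ := hf
  exact ⟨F, hF, fun z hz => h z hz ▸ hd z hz⟩

theorem coord_mul_mem_primitive (hli : l ≠ i) (hf : f ∈ primitive i (pointSpan S)) :
    (fun z => z l * f z) ∈ primitive i (pointSpan S) := by
  obtain ⟨F, hF, hd⟩ := hf
  exact ⟨_, coord_mul_mem_polySpan l hF, hd.coord_mul hli⟩

theorem pow_mul_mem_primitive_of_byParts (p : ℕ) (hg : IsPartialAntideriv i g f)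
    (hF : (fun z => z i ^ (p + 1) * g z) ∈ N)
    (hf : (fun z => z i ^ (p + 1) * f z) ∈ primitive i N) :
    (fun z => z i ^ p * g z) ∈ primitive i N := by
  have h := sub_mem (show _ ∈ primitive i N from ⟨_, hF, hg.pow_mul (p + 1)⟩) hf
  refine primitive_congr ((primitive i N).smul_mem ((p + 1 : ℚ)⁻¹) h) fun z _ => ?_
  have : (p : ℝ) + 1 ≠ 0 := by positivity
  simp only [Nat.cast_add, Nat.cast_one, add_tsub_cancel_right, Pi.smul_apply, Pi.sub_apply,
      Rat.smul_def, Rat.cast_inv, Rat.cast_add, Rat.cast_natCast, Rat.cast_one]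
  field_simp

theorem pointSpan_le_primitive
    (h : ∀ g ∈ T, ∀ p : ℕ, (fun z => z i ^ p * g z) ∈ primitive i (pointSpan S)) :
    pointSpan T ≤ primitive i (pointSpan S) := by
  let M : Submodule ℚ ((Fin n → ℝ) → ℝ) :=
    ⨅ p : ℕ, (primitive i (pointSpan S)).comap (LinearMap.mulLeft ℚ fun z => z i ^ p)
  have hM {g : (Fin n → ℝ) → ℝ} :
      g ∈ M ↔ ∀ p : ℕ, (fun z => z i ^ p * g z) ∈ primitive i (pointSpan S) :=
    Submodule.mem_iInf _
  have hle : pointSpan T ≤ M := by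
    refine polySpan_le (fun g hg => hM.mpr (h g hg)) fun l g hg => hM.mpr fun p => ?_
    by_cases hl : l = i
    · subst hl
      exact primitive_congr (hM.mp hg (p + 1)) fun z _ => by ring
    · exact primitive_congr (coord_mul_mem_primitive hl (hM.mp hg p)) fun z _ => by ring
  intro f hf
  simpa using hM.mp (hle hf) 0

end Primitive

section Kernels

variable {i j k : Fin 3} {N : Submodule ℚ ((Fin 3 → ℝ) → ℝ)} {g : (Fin 3 → ℝ) → ℝ}

/-- The terms whose polynomial span contains the iterated antiderivatives of the Newton kernel
from the third one on. The factors `z_i` make them continuous. -/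
inductive IsRegularTerm : ((Fin 3 → ℝ) → ℝ) → Prop
  | rho : IsRegularTerm rho
  | artanh {i j : Fin 3} (h : i ≠ j) : IsRegularTerm fun z => z i * artanhTerm j z
  | arctan {i j k : Fin 3} (h : IsTriple i j k) : IsRegularTerm fun z => z i * arctanTerm i j k z

/-- The set of regular terms. -/
def regularTerms : Set ((Fin 3 → ℝ) → ℝ) := {g | IsRegularTerm g}

/-- The polynomial span of the regular terms. -/
abbrev regularSpan : Submodule ℚ ((Fin 3 → ℝ) → ℝ) := pointSpan regularTerms

theorem IsRegularTerm.mem (h : IsRegularTerm g) : g ∈ regularSpan := subset_polySpan h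

theorem mul_div_rho_mem_primitive (hji : j ≠ i) :
    (fun z => z j / rho z) ∈ primitive i regularSpan :=
  primitive_congr ⟨_, (IsRegularTerm.artanh hji).mem,
    (isPartialAntideriv_artanhTerm_self i).coord_mul hji⟩ fun z _ => by ring

theorem pow_add_two_div_rho_mem_primitive (p : ℕ)
    (hp : ∀ j, j ≠ i → (fun z => z j * (z i ^ p / rho z)) ∈ primitive i regularSpan) :
    (fun z => z i ^ (p + 2) / rho z) ∈ primitive i regularSpan := by
  obtain ⟨j, k, h⟩ := exists_isTriple i
  have hρ : (fun z => ((p + 1 : ℕ) : ℝ) * z i ^ p * rho z + z i ^ (p + 1) * (z i / rho z)) ∈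
      primitive i regularSpan :=
    ⟨_, coord_pow_mul_mem_polySpan i (p + 1) IsRegularTerm.rho.mem,
      (isPartialAntideriv_rho i).pow_mul (p + 1)⟩
  have hjk := add_mem (coord_mul_mem_primitive h.ne_left.symm (hp j h.ne_left.symm))
    (coord_mul_mem_primitive h.ne_outer.symm (hp k h.ne_outer.symm))
  refine primitive_congr ((primitive i regularSpan).smul_mem ((p + 2 : ℚ)⁻¹)
    (sub_mem hρ ((primitive i regularSpan).smul_mem (p + 1 : ℚ) hjk))) fun z hz => ?_
  have hz' := (rho_pos_of_apply_ne_zero (hz i)).ne'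
  have : (p : ℝ) + 2 ≠ 0 := by positivity
  simp only [Nat.cast_add, Nat.cast_one, smul_add, Pi.smul_apply, Pi.sub_apply, Pi.add_apply,
      Rat.smul_def, Rat.cast_add, Rat.cast_natCast, Rat.cast_one, Rat.cast_inv, Rat.cast_ofNat]
  field_simp
  rw [rho_sq h]
  ring

theorem mul_pow_div_rho_mem_primitive (hji : j ≠ i) (p : ℕ) :
    (fun z => z j * (z i ^ p / rho z)) ∈ primitive i regularSpan := by
  induction p using Nat.twoStepInduction generalizing j with
  | zero => exact primitive_congr (mul_div_rho_mem_primitive hji) fun z _ => by ring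
  | one =>
    exact primitive_congr (coord_mul_mem_primitive hji
      ⟨_, IsRegularTerm.rho.mem, isPartialAntideriv_rho i⟩) fun z _ => by ring
  | more p ih _ =>
    exact coord_mul_mem_primitive hji (pow_add_two_div_rho_mem_primitive p fun _ => ih)

theorem pow_succ_div_rho_mem_primitive (p : ℕ) :
    (fun z => z i ^ (p + 1) / rho z) ∈ primitive i regularSpan := by
  rcases p with _ | p
  · exact primitive_congr ⟨_, IsRegularTerm.rho.mem, isPartialAntideriv_rho i⟩ fun z _ => by ring
  · exact pow_add_two_div_rho_mem_primitive p fun _ hji => mul_pow_div_rho_mem_primitive hji p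

theorem pow_add_two_mul_axialKernel_mem_primitive_of_sq_mul (h : IsTriple i j k) (p : ℕ)
    (hp : (fun z => z k * (z k * (z i ^ p * axialKernel j z))) ∈ primitive i regularSpan) :
    (fun z => z i ^ (p + 2) * axialKernel j z) ∈ primitive i regularSpan := by
  refine primitive_congr (sub_mem (mul_pow_div_rho_mem_primitive h.ne_left.symm p) hp)
    fun z hz => ?_
  have hρ := (rho_pos_of_apply_ne_zero (hz i)).ne'
  have hi := hz i
  simp only [Pi.sub_apply, axialKernel_eq h]
  field_simp
  ring

theorem mul_mul_axialKernel_mem_primitive (h : IsTriple i j k) :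
    (fun z => z k * (z i * axialKernel j z)) ∈ primitive i regularSpan := by
  have hki := h.ne_outer.symm
  refine primitive_congr (neg_mem ⟨_, (IsRegularTerm.artanh h.ne_right.symm).mem,
    (isPartialAntideriv_artanhTerm_of_ne h.ne_left).coord_mul hki⟩) fun z _ => ?_
  simp

theorem isPartialAntideriv_mul_arctanTerm_of_ne (h : IsTriple i j k) :
    IsPartialAntideriv i (fun z => z k * arctanTerm k i j z)
      fun z => z k * (z k * axialKernel j z) :=
  (isPartialAntideriv_arctanTerm_of_ne h).coord_mul h.ne_outer.symm

theorem sq_mul_pow_mul_axialKernel_mem_primitive (h : IsTriple i j k) (p : ℕ) :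
    (fun z => z k * (z k * (z i ^ p * axialKernel j z))) ∈ primitive i regularSpan := by
  have hki := h.ne_outer.symm
  induction p using Nat.twoStepInduction with
  | zero =>
    exact primitive_congr ⟨_, (IsRegularTerm.arctan h.rotate.rotate).mem,
      isPartialAntideriv_mul_arctanTerm_of_ne h⟩ fun z _ => by ring
  | one =>
    exact primitive_congr (coord_mul_mem_primitive hki (mul_mul_axialKernel_mem_primitive h))
      fun z _ => by ring
  | more p ih _ =>
    exact coord_mul_mem_primitive hki
      (coord_mul_mem_primitive hki (pow_add_two_mul_axialKernel_mem_primitive_of_sq_mul h p ih))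

theorem pow_add_two_mul_axialKernel_mem_primitive (h : IsTriple i j k) (p : ℕ) :
    (fun z => z i ^ (p + 2) * axialKernel j z) ∈ primitive i regularSpan :=
  pow_add_two_mul_axialKernel_mem_primitive_of_sq_mul h p
    (sq_mul_pow_mul_axialKernel_mem_primitive h p)

theorem pow_mul_rho_mem_primitive (p : ℕ) :
    (fun z => z i ^ p * rho z) ∈ primitive i regularSpan := by
  obtain ⟨j, k, h⟩ := exists_isTriple i
  have hj := coord_mul_mem_primitive h.ne_left.symm
    (mul_pow_div_rho_mem_primitive h.ne_left.symm p)
  have hk := coord_mul_mem_primitive h.ne_outer.symm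
    (mul_pow_div_rho_mem_primitive h.ne_outer.symm p)
  refine primitive_congr (add_mem (pow_succ_div_rho_mem_primitive (p + 1)) (add_mem hj hk))
    fun z hz => ?_
  have hρ := (rho_pos_of_apply_ne_zero (hz i)).ne'
  simp only [Pi.add_apply]
  field_simp
  rw [rho_sq h]
  ring

theorem pow_mul_mul_artanhTerm_self_mem_primitive (hji : j ≠ i) (p : ℕ) :
    (fun z => z i ^ p * (z j * artanhTerm i z)) ∈ primitive i regularSpan := by
  refine pow_mul_mem_primitive_of_byParts p ((isPartialAntideriv_artanhTerm_self i).coord_mul hji)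
    (coord_pow_mul_mem_polySpan i (p + 1) (IsRegularTerm.artanh hji).mem) ?_
  exact primitive_congr (mul_pow_div_rho_mem_primitive hji (p + 1)) fun z _ => by ring

theorem pow_mul_artanhTerm_mem_primitive (hij : i ≠ j) (p : ℕ) :
    (fun z => z i ^ p * artanhTerm j z) ∈ primitive i regularSpan := by
  obtain ⟨k, h⟩ := exists_isTriple_of_ne hij
  refine pow_mul_mem_primitive_of_byParts p (isPartialAntideriv_artanhTerm_of_ne hij) ?_ ?_
  · simpa only [pow_succ, mul_assoc] using
      coord_pow_mul_mem_polySpan i p (IsRegularTerm.artanh hij).mem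
  · refine primitive_congr (neg_mem (pow_add_two_mul_axialKernel_mem_primitive h p)) fun z _ => ?_
    simp only [Pi.neg_apply]
    ring

theorem pow_mul_mul_arctanTerm_self_mem_primitive (h : IsTriple i j k) (p : ℕ) :
    (fun z => z i ^ p * (z i * arctanTerm i j k z)) ∈ primitive i regularSpan := by
  have hmem : (fun z => z i ^ (p + 1) * arctanTerm i j k z) ∈ primitive i regularSpan := by
    refine pow_mul_mem_primitive_of_byParts (p + 1) (isPartialAntideriv_arctanTerm_self h) ?_ ?_
    · simpa only [pow_succ _ (p + 1), mul_assoc] using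
        coord_pow_mul_mem_polySpan i (p + 1) (IsRegularTerm.arctan h).mem
    · refine primitive_congr (neg_mem (add_mem
        (coord_mul_mem_primitive h.ne_left.symm
          (pow_add_two_mul_axialKernel_mem_primitive h.swap p))
        (coord_mul_mem_primitive h.ne_outer.symm
          (pow_add_two_mul_axialKernel_mem_primitive h p))))
        fun z _ => ?_
      simp only [Pi.neg_apply, Pi.add_apply]
      ring
  exact primitive_congr hmem fun z _ => by ring

theorem pow_mul_mul_arctanTerm_of_ne_mem_primitive (h : IsTriple i j k) (p : ℕ) :
    (fun z => z i ^ p * (z k * arctanTerm k i j z)) ∈ primitive i regularSpan := by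
  refine pow_mul_mem_primitive_of_byParts p (isPartialAntideriv_mul_arctanTerm_of_ne h)
    (coord_pow_mul_mem_polySpan i (p + 1) (IsRegularTerm.arctan h.rotate.rotate).mem) ?_
  exact primitive_congr (sq_mul_pow_mul_axialKernel_mem_primitive h (p + 1)) fun z _ => by ring

theorem regularSpan_le_primitive (i : Fin 3) : regularSpan ≤ primitive i regularSpan := by
  refine pointSpan_le_primitive fun g hg p => ?_
  cases hg with
  | rho => exact pow_mul_rho_mem_primitive p
  | @artanh l m hlm =>
    by_cases hm : m = i
    · subst hm
      exact pow_mul_mul_artanhTerm_self_mem_primitive hlm p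
    by_cases hl : l = i
    · subst hl
      exact primitive_congr (pow_mul_artanhTerm_mem_primitive hlm (p + 1)) fun z _ => by ring
    · exact primitive_congr (coord_mul_mem_primitive hl
        (pow_mul_artanhTerm_mem_primitive (Ne.symm hm) p)) fun z _ => by ring
  | @arctan l m n h =>
    rcases h.eq_or i with rfl | rfl | rfl
    · exact pow_mul_mul_arctanTerm_self_mem_primitive h p
    · exact pow_mul_mul_arctanTerm_of_ne_mem_primitive h.rotate p
    · simpa only [arctanTerm_comm l i m] using
        pow_mul_mul_arctanTerm_of_ne_mem_primitive h.swap.rotate p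

/-- The terms needed for the antiderivatives of the kernels `1 / ρ` and `z_k / ρ³` with respect to
the `k`-th coordinate. -/
def firstTerms (k : Fin 3) : Set ((Fin 3 → ℝ) → ℝ) :=
  {fun z => 1 / rho z, artanhTerm k} ∪ regularTerms

/-- The terms needed for the antiderivatives of the functions in the span of `firstTerms` with
respect to the `i`-th coordinate. -/
def secondTerms (i : Fin 3) : Set ((Fin 3 → ℝ) → ℝ) := {artanhTerm i} ∪ regularTerms

theorem regularSpan_le_firstTerms (k : Fin 3) : regularSpan ≤ pointSpan (firstTerms k) :=
  polySpan_mono subset_union_right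

theorem regularSpan_le_secondTerms (i : Fin 3) : regularSpan ≤ pointSpan (secondTerms i) :=
  polySpan_mono subset_union_right

theorem pow_mul_inv_rho_mem_primitive (hN : regularSpan ≤ N) (hi : artanhTerm i ∈ N) (p : ℕ) :
    (fun z => z i ^ p * (1 / rho z)) ∈ primitive i N := by
  rcases p with _ | p
  · simpa using (show _ ∈ primitive i N from ⟨_, hi, isPartialAntideriv_artanhTerm_self i⟩)
  · exact primitive_congr (primitive_mono hN (pow_succ_div_rho_mem_primitive p))
      fun z _ => by ring

theorem pointSpan_inv_rho_le_primitive (k : Fin 3) :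
    pointSpan {fun z => 1 / rho z} ≤ primitive k (pointSpan (firstTerms k)) :=
  pointSpan_le_primitive fun _ hg p => hg ▸ pow_mul_inv_rho_mem_primitive
    (regularSpan_le_firstTerms k) (subset_polySpan (.inl (.inr rfl))) p

theorem pointSpan_div_rho_cube_le_primitive (k : Fin 3) :
    pointSpan {fun z => z k / rho z ^ 3} ≤ primitive k (pointSpan (firstTerms k)) := by
  refine pointSpan_le_primitive fun _ hg p => hg ▸ ?_
  have hρ : (fun z => 1 / rho z) ∈ pointSpan (firstTerms k) := subset_polySpan (.inl (.inl rfl))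
  have hparts : (fun z => p * z k ^ (p - 1) * (1 / rho z) + z k ^ p * -(z k / rho z ^ 3)) ∈
      primitive k (pointSpan (firstTerms k)) :=
    ⟨_, coord_pow_mul_mem_polySpan k p hρ, (isPartialAntideriv_inv_rho k).pow_mul p⟩
  have hlower := pow_mul_inv_rho_mem_primitive (regularSpan_le_firstTerms k)
    (subset_polySpan (.inl (.inr rfl))) (p - 1)
  refine primitive_congr (sub_mem ((primitive k _).smul_mem (p : ℚ) hlower) hparts) fun z _ => ?_
  simp only [one_div, mul_neg, Pi.sub_apply, Pi.smul_apply, Rat.smul_def, Rat.cast_natCast]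
  ring

theorem pointSpan_firstTerms_le_primitive (hik : i ≠ k) :
    pointSpan (firstTerms k) ≤ primitive i (pointSpan (secondTerms i)) := by
  have hN := regularSpan_le_secondTerms i
  refine pointSpan_le_primitive fun g hg p => ?_
  rcases hg with (rfl | rfl) | hg
  · exact pow_mul_inv_rho_mem_primitive hN (subset_polySpan (.inl rfl)) p
  · exact primitive_mono hN (pow_mul_artanhTerm_mem_primitive hik p)
  · exact primitive_mono hN (regularSpan_le_primitive i
      (coord_pow_mul_mem_polySpan i p (IsRegularTerm.mem hg)))

theorem pointSpan_secondTerms_le_primitive (hji : j ≠ i) :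
    pointSpan (secondTerms i) ≤ primitive j regularSpan := by
  refine pointSpan_le_primitive fun g hg p => ?_
  rcases hg with rfl | hg
  · exact pow_mul_artanhTerm_mem_primitive hji p
  · exact regularSpan_le_primitive j (coord_pow_mul_mem_polySpan j p (IsRegularTerm.mem hg))

end Kernels

/-! ### Integration over boxes -/

section RegularPrimitive

variable {i k : Fin 3} {T : Set ((Fin 3 → ℝ) → ℝ)} {f g : (Fin 3 → ℝ) → ℝ}

theorem IsRegularTerm.continuous (h : IsRegularTerm g) : Continuous g := by
  cases h with
  | rho => exact continuous_rho
  | artanh h => exact continuous_mul_artanhTerm h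
  | arctan h => exact continuous_mul_arctanTerm _ _ _

theorem continuous_of_mem_regularSpan (hf : f ∈ regularSpan) : Continuous f :=
  continuous_of_mem_polySpan continuous_apply (fun _ hg => IsRegularTerm.continuous hg) hf

theorem isLineContinuous_of_mem_firstTerms (hf : f ∈ pointSpan (firstTerms k)) :
    IsLineContinuous f := by
  intro i z hz
  obtain ⟨j, l, h⟩ := exists_isTriple i
  have hj := hz j h.ne_left.symm
  refine continuousAt_of_mem_polySpan (fun l => (continuous_apply l).continuousAt) ?_ hf
  rintro g ((rfl | rfl) | hg)
  · exact continuousAt_const.div continuous_rho.continuousAt (rho_pos_of_apply_ne_zero hj).ne'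
  · by_cases hjk : j = k
    · exact continuousAt_artanhTerm (hjk ▸ h.ne_right.symm) (hz l h.ne_outer.symm)
    · exact continuousAt_artanhTerm hjk hj
  · exact (IsRegularTerm.continuous hg).continuousAt

theorem secondTerms_subset_firstTerms (i : Fin 3) : secondTerms i ⊆ firstTerms i :=
  union_subset_union_left _ (singleton_subset_iff.mpr (.inr rfl))

/-- The locally integrable functions whose integrals over boxes are corner sums of functions in
`regularSpan`. -/
def HasRegularPrimitive (f : (Fin 3 → ℝ) → ℝ) : Prop :=
  LocallyIntegrable f ∧ ∃ F ∈ regularSpan, IsCornerPrimitive F f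

theorem hasRegularPrimitive_of_mem_primitive (hint : LocallyIntegrable f)
    (hcont : ∀ z, z ≠ 0 → ContinuousAt f z) (hf : f ∈ primitive k (pointSpan (firstTerms k))) :
    HasRegularPrimitive f := by
  obtain ⟨j, p, rfl⟩ : ∃ (j : Fin 3) (p : Fin 2), j.succAbove (p.succAbove 0) = k := by
    clear hf
    revert k
    decide
  have hik : j.succAbove p ≠ j.succAbove (p.succAbove 0) :=
    Fin.succAbove_right_injective.ne (Fin.succAbove_ne p 0).symm
  obtain ⟨f₁, hf₁, h₁⟩ := hf
  obtain ⟨f₂, hf₂, h₂⟩ := pointSpan_firstTerms_le_primitive hik hf₁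
  obtain ⟨f₃, hf₃, h₃⟩ := pointSpan_secondTerms_le_primitive (Fin.succAbove_ne j p).symm hf₂
  have c₀ : IsLineContinuous f := by
    intro i z hz
    obtain ⟨j, _, h⟩ := exists_isTriple i
    exact hcont z fun h0 => hz j h.ne_left.symm (congrFun h0 j)
  have c₁ := isLineContinuous_of_mem_firstTerms hf₁
  have c₂ := isLineContinuous_of_mem_firstTerms
    (polySpan_mono (secondTerms_subset_firstTerms _) hf₂)
  have c₃ : IsLineContinuous f₃ := fun _ _ _ => (continuous_of_mem_regularSpan hf₃).continuousAt
  exact ⟨hint, f₃, hf₃, isCornerPrimitive_of_isLinePrimitive j p hint hcont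
    (h₁.isLinePrimitive c₁ c₀) (h₂.isLinePrimitive c₂ c₁) (h₃.isLinePrimitive c₃ c₂)⟩

theorem locallyIntegrable_of_mem_pointSpan (hT : ∀ g ∈ T, LocallyIntegrable g)
    (hf : f ∈ pointSpan T) : LocallyIntegrable f := by
  refine polySpan_induction hT locallyIntegrable_zero (fun _ _ h h' => h.add h')
    (fun q f h => ?_) (fun l f h => ?_) hf
  · simpa only [Pi.smul_def, Rat.smul_def] using! h.smul (q : ℝ)
  · exact h.continuous_mul (continuous_apply l)

theorem hasRegularPrimitive_of_mem_pointSpan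
    (hT : pointSpan T ≤ primitive k (pointSpan (firstTerms k)))
    (hint : ∀ g ∈ T, LocallyIntegrable g) (hcont : ∀ g ∈ T, ∀ z, z ≠ 0 → ContinuousAt g z)
    (hf : f ∈ pointSpan T) : HasRegularPrimitive f :=
  hasRegularPrimitive_of_mem_primitive (locallyIntegrable_of_mem_pointSpan hint hf)
    (fun z hz => continuousAt_of_mem_polySpan (fun l => (continuous_apply l).continuousAt)
      (fun g hg => hcont g hg z hz) hf) (hT hf)

theorem hasRegularPrimitive_of_mem_regularSpan (hf : f ∈ regularSpan) : HasRegularPrimitive f :=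
  have hc := continuous_of_mem_regularSpan hf
  hasRegularPrimitive_of_mem_primitive (k := 0) hc.locallyIntegrable (fun _ _ => hc.continuousAt)
    (primitive_mono (regularSpan_le_firstTerms 0) (regularSpan_le_primitive 0 hf))

end RegularPrimitive

section SectionPrimitive

variable {n : ℕ}

theorem ae_forall_apply_ne (c : Fin n → ℝ) : ∀ᵐ x : Fin n → ℝ, ∀ i, x i ≠ c i :=
  ae_all_iff.mpr fun i => Measure.ae_eval_ne (α := fun _ => ℝ) (μ := fun _ => volume) i (c i)

/-- For almost every point `x`, the integral over `y` in a box of `K (x, y)` is the corner sum of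
`F (x, ·)`. The exceptional points share a coordinate with one of the corners. -/
def IsSectionPrimitive (F K : (Fin n → ℝ) × (Fin n → ℝ) → ℝ) : Prop :=
  ∀ x a b : Fin n → ℝ, a ≤ b → (∀ i, x i ≠ a i) → (∀ i, x i ≠ b i) →
    IntegrableOn (fun y => K (x, y)) (Icc a b) ∧
      ∫ y in Icc a b, K (x, y) = cornerSum (fun y => F (x, y)) a b

theorem IsSectionPrimitive.add {F G K L : (Fin n → ℝ) × (Fin n → ℝ) → ℝ}
    (hF : IsSectionPrimitive F K) (hG : IsSectionPrimitive G L) :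
    IsSectionPrimitive (F + G) (K + L) := by
  intro x a b hab ha hb
  obtain ⟨hK, hF⟩ := hF x a b hab ha hb
  obtain ⟨hL, hG⟩ := hG x a b hab ha hb
  refine ⟨hK.add hL, ?_⟩
  simp only [Pi.add_apply, integral_add hK hL, hF, hG, cornerSum, mul_add, Finset.sum_add_distrib]

theorem IsSectionPrimitive.fst_mul {F K : (Fin n → ℝ) × (Fin n → ℝ) → ℝ}
    (hF : IsSectionPrimitive F K) (c : (Fin n → ℝ) → ℝ) :
    IsSectionPrimitive (fun w => c w.1 * F w) fun w => c w.1 * K w := by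
  intro x a b hab ha hb
  obtain ⟨hK, hF⟩ := hF x a b hab ha hb
  refine ⟨hK.const_mul (c x), ?_⟩
  simp only [integral_const_mul, hF, cornerSum, Finset.mul_sum]
  exact Finset.sum_congr rfl fun _ _ => mul_left_comm ..

theorem IsCornerPrimitive.comp_sub {F f : (Fin n → ℝ) → ℝ} (h : IsCornerPrimitive F f)
    (hf : LocallyIntegrable f) :
    IsSectionPrimitive (fun w => (-1) ^ n * F (w.1 - w.2)) fun w => f (w.1 - w.2) := by
  intro x a b hab ha hb
  have hpre : (fun y => x - y) ⁻¹' Icc (x - b) (x - a) = Icc a b := by simp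
  have hsub := Measure.measurePreserving_sub_left (volume : Measure (Fin n → ℝ)) x
  have hemb := (MeasurableEquiv.subLeft x).measurableEmbedding
  have hint : IntegrableOn f (Icc (x - b) (x - a)) := hf.integrableOn_isCompact isCompact_Icc
  rw [← hsub.integrableOn_comp_preimage hemb, hpre] at hint
  refine ⟨hint, ?_⟩
  calc ∫ y in Icc a b, f (x - y)
      = ∫ z in Icc (x - b) (x - a), f z := by rw [← hsub.setIntegral_preimage_emb hemb f, hpre]
    _ = cornerSum F (x - b) (x - a) :=
        h _ _ (sub_le_sub_left hab x) (fun i => sub_ne_zero.mpr (hb i))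
          fun i => sub_ne_zero.mpr (ha i)
    _ = cornerSum (fun y => (-1) ^ n * F (x - y)) a b := by
        rw [cornerSum_sub_left, cornerSum, cornerSum, Finset.mul_sum]
        exact Finset.sum_congr rfl fun _ _ => mul_left_comm ..

theorem IsSectionPrimitive.integral_eq {F K : (Fin n → ℝ) × (Fin n → ℝ) → ℝ}
    (h : IsSectionPrimitive F K) (hF : Continuous F) (hK : Continuous K) (x : Fin n → ℝ)
    {a b : Fin n → ℝ} (hab : a ≤ b) :
    ∫ y in Icc a b, K (x, y) = cornerSum (fun y => F (x, y)) a b := by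
  have hgen : Dense {x : Fin n → ℝ | (∀ i, x i ≠ a i) ∧ ∀ i, x i ≠ b i} :=
    Measure.dense_of_ae ((ae_forall_apply_ne a).and (ae_forall_apply_ne b))
  have hleft : Continuous fun x => ∫ y in Icc a b, K (x, y) :=
    continuous_parametric_integral_of_continuous (f := fun x y => K (x, y)) hK isCompact_Icc
  have hright : Continuous fun x => cornerSum (fun y => F (x, y)) a b := by
    unfold cornerSum
    fun_prop
  exact congrFun (hleft.ext_on hgen hright fun x hx => (h x a b hab hx.1 hx.2).2) x

end SectionPrimitive

section PairSpan

variable {n : ℕ} {T : Set ((Fin n → ℝ) → ℝ)} {K : (Fin n → ℝ) × (Fin n → ℝ) → ℝ}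

/-- The combinations of the functions `g (x - y)`, where `g ∈ T`, with rational polynomials in the
coordinates of the points `x` and `y` as coefficients. They are written as polynomials in the
coordinates of `x` and `x - y`. -/
abbrev pairSpan (T : Set ((Fin n → ℝ) → ℝ)) :
    Submodule ℚ ((Fin n → ℝ) × (Fin n → ℝ) → ℝ) :=
  polySpan (fun i (w : (Fin n → ℝ) × (Fin n → ℝ)) => w.1 i)
    ((fun (f : (Fin n → ℝ) → ℝ) w => f (w.1 - w.2)) '' pointSpan T)

theorem comp_sub_mem_pairSpan {f : (Fin n → ℝ) → ℝ} (hf : f ∈ pointSpan T) :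
    (fun w => f (w.1 - w.2)) ∈ pairSpan T :=
  subset_polySpan ⟨f, hf, rfl⟩

theorem snd_mul_mem_pairSpan (l : Fin n) (hK : K ∈ pairSpan T) :
    (fun w => w.2 l * K w) ∈ pairSpan T := by
  refine polySpan_induction (p := fun K => (fun w => w.2 l * K w) ∈ pairSpan T) ?_
    ?_ (fun K L hK hL => ?_) (fun q K hK => ?_) (fun i K hK => ?_) hK
  · rintro _ ⟨f, hf, rfl⟩
    convert sub_mem (coord_mul_mem_polySpan l (comp_sub_mem_pairSpan hf))
      (comp_sub_mem_pairSpan (coord_mul_mem_polySpan l hf)) using 1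
    funext w
    simp only [Pi.sub_apply]
    ring
  · simpa only [Pi.zero_apply, mul_zero] using! (pairSpan T).zero_mem
  · simpa only [Pi.add_apply, mul_add] using! add_mem hK hL
  · simpa only [Pi.smul_apply, mul_smul_comm] using! (pairSpan T).smul_mem q hK
  · simpa only [mul_left_comm] using coord_mul_mem_polySpan i hK

theorem snd_pow_mul_mem_pairSpan (l : Fin n) (p : ℕ) (hK : K ∈ pairSpan T) :
    (fun w => w.2 l ^ p * K w) ∈ pairSpan T := by
  induction p with
  | zero => simpa using hK
  | succ p ih =>
    convert snd_mul_mem_pairSpan l ih using 2 with w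
    ring

end PairSpan

section DoubleIntegral

variable {T : Set ((Fin 3 → ℝ) → ℝ)} {K : (Fin 3 → ℝ) × (Fin 3 → ℝ) → ℝ}

theorem continuous_of_mem_pairSpan (hK : K ∈ pairSpan regularTerms) : Continuous K := by
  refine continuous_of_mem_polySpan (fun i => by fun_prop) ?_ hK
  rintro _ ⟨f, hf, rfl⟩
  exact (continuous_of_mem_regularSpan hf).comp (continuous_fst.sub continuous_snd)

theorem artanh_neg_eq_neg_artanh (x : ℝ) : Real.artanh (-x) = -Real.artanh x := by
  rw [Real.artanh, Real.artanh, ← Real.log_inv, ← Real.sqrt_inv, inv_div, sub_neg_eq_add,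
    sub_eq_add_neg]

theorem IsRegularTerm.neg {g : (Fin 3 → ℝ) → ℝ} (h : IsRegularTerm g) (z : Fin 3 → ℝ) :
    g (-z) = g z := by
  cases h with
  | rho => exact rho_neg z
  | artanh h => simp [artanhTerm, rho_neg, neg_div, artanh_neg_eq_neg_artanh]
  | arctan h => simp [arctanTerm, rho_neg, div_neg]

theorem comp_neg_mem_regularSpan {f : (Fin 3 → ℝ) → ℝ} (hf : f ∈ regularSpan) :
    (fun z => f (-z)) ∈ regularSpan := by
  refine polySpan_induction (p := fun f => (fun z => f (-z)) ∈ regularSpan) (fun g hg => ?_)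
    regularSpan.zero_mem (fun _ _ => add_mem) (fun q _ => regularSpan.smul_mem q)
    (fun l f hf => ?_) hf
  · simpa only [IsRegularTerm.neg hg] using IsRegularTerm.mem hg
  · simpa only [Pi.neg_apply, neg_mul] using! neg_mem (coord_mul_mem_polySpan l hf)

theorem comp_swap_mem_pairSpan (hK : K ∈ pairSpan regularTerms) :
    (fun w => K w.swap) ∈ pairSpan regularTerms := by
  refine polySpan_induction (p := fun K => (fun w => K w.swap) ∈ pairSpan regularTerms) ?_
    (pairSpan _).zero_mem (fun _ _ => add_mem) (fun q _ => (pairSpan _).smul_mem q)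
    (fun l _ => snd_mul_mem_pairSpan l) hK
  rintro _ ⟨f, hf, rfl⟩
  simpa only [neg_sub] using! comp_sub_mem_pairSpan (comp_neg_mem_regularSpan hf)

theorem exists_isSectionPrimitive (hT : ∀ f ∈ pointSpan T, HasRegularPrimitive f)
    (hK : K ∈ pairSpan T) : ∃ F ∈ pairSpan regularTerms, IsSectionPrimitive F K := by
  refine polySpan_induction
    (p := fun K => ∃ F ∈ pairSpan regularTerms, IsSectionPrimitive F K) ?_ ?_ ?_ ?_ ?_ hK
  · rintro _ ⟨f, hf, rfl⟩
    obtain ⟨hint, F, hF, hFf⟩ := hT f hf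
    refine ⟨_, ?_, hFf.comp_sub hint⟩
    convert neg_mem (comp_sub_mem_pairSpan hF) using 1
    funext w
    simp [pow_succ]
  · exact ⟨0, zero_mem _, fun x a b _ _ _ => ⟨integrableOn_zero, by simp [cornerSum]⟩⟩
  · rintro K L ⟨F, hF, hFK⟩ ⟨G, hG, hGL⟩
    exact ⟨F + G, add_mem hF hG, hFK.add hGL⟩
  · rintro q K ⟨F, hF, hFK⟩
    refine ⟨q • F, (pairSpan _).smul_mem q hF, ?_⟩
    simpa only [← Rat.smul_def] using! hFK.fst_mul fun _ => (q : ℝ)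
  · rintro l K ⟨F, hF, hFK⟩
    exact ⟨_, coord_mul_mem_polySpan l hF, hFK.fst_mul fun x => x l⟩

theorem exists_integral_fst_eq (hK : K ∈ pairSpan regularTerms) :
    ∃ F ∈ pairSpan regularTerms, ∀ (y : Fin 3 → ℝ) {a b : Fin 3 → ℝ}, a ≤ b →
      ∫ x in Icc a b, K (x, y) = cornerSum (fun x => F (x, y)) a b := by
  have hswap := comp_swap_mem_pairSpan hK
  obtain ⟨F, hF, hFK⟩ :=
    exists_isSectionPrimitive (fun _ => hasRegularPrimitive_of_mem_regularSpan) hswap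
  exact ⟨fun w => F w.swap, comp_swap_mem_pairSpan hF, fun y a b hab =>
    hFK.integral_eq (continuous_of_mem_pairSpan hF) (continuous_of_mem_pairSpan hswap) y hab⟩

theorem exists_doubleIntegral_eq (hT : ∀ f ∈ pointSpan T, HasRegularPrimitive f)
    (hK : K ∈ pairSpan T) :
    ∃ F ∈ pairSpan regularTerms, ∀ a b a' b' : Fin 3 → ℝ, a ≤ b → a' ≤ b' →
      doubleIntegral (fun x y => K (x, y)) a b a' b' =
        cornerSum (fun y => cornerSum (fun x => F (x, y)) a b) a' b' := by
  obtain ⟨G, hG, hGK⟩ := exists_isSectionPrimitive hT hK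
  obtain ⟨F, hF, hFG⟩ := exists_integral_fst_eq hG
  have hGc := continuous_of_mem_pairSpan hG
  refine ⟨F, hF, fun a b a' b' hab hab' => ?_⟩
  calc ∫ x in Icc a b, ∫ y in Icc a' b', K (x, y)
      = ∫ x in Icc a b, cornerSum (fun y => G (x, y)) a' b' := by
        refine integral_congr_ae (ae_restrict_of_ae ?_)
        filter_upwards [ae_forall_apply_ne a', ae_forall_apply_ne b'] with x ha hb
        exact (hGK x a' b' hab' ha hb).2
    _ = cornerSum (fun y => ∫ x in Icc a b, G (x, y)) a' b' := by
        simp only [cornerSum, ← integral_const_mul]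
        exact integral_finsetSum _ fun s _ =>
          (Continuous.continuousOn (by fun_prop)).integrableOn_compact isCompact_Icc
    _ = cornerSum (fun y => cornerSum (fun x => F (x, y)) a b) a' b' := by
        simp only [hFG _ hab]

end DoubleIntegral

/-! ### Elementary combinations -/

section Elementary

open MvPolynomial

theorem elementaryCombination_add (A B C A' B' C' : Coeffs) (a b a' b' : Fin 3 → ℝ) :
    elementaryCombination (A + A') (B + B') (C + C') a b a' b' =
      elementaryCombination A B C a b a' b' + elementaryCombination A' B' C' a b a' b' := by
  simp only [elementaryCombination, ← Finset.sum_add_distrib, Pi.add_apply, map_add]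
  refine Finset.sum_congr rfl fun s _ => Finset.sum_congr rfl fun s' _ =>
    Finset.sum_congr rfl fun π _ => ?_
  split_ifs
  · ring
  · simp

theorem elementaryCombination_smul (P : MvPolynomial BoundVar ℚ) (A B C : Coeffs)
    (a b a' b' : Fin 3 → ℝ) :
    elementaryCombination (P • A) (P • B) (P • C) a b a' b' =
      aeval (bounds a b a' b') P * elementaryCombination A B C a b a' b' := by
  simp only [elementaryCombination, Finset.mul_sum, Pi.smul_apply, smul_eq_mul, map_mul]
  refine Finset.sum_congr rfl fun s _ => Finset.sum_congr rfl fun s' _ =>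
    Finset.sum_congr rfl fun π _ => ?_
  split_ifs
  · ring
  · simp

/-- The functions of the integration bounds that are elementary combinations. -/
def elementary : Submodule ℚ ((Fin 3 → ℝ) → (Fin 3 → ℝ) → (Fin 3 → ℝ) → (Fin 3 → ℝ) → ℝ) where
  carrier := {Φ | ∃ A B C : Coeffs, ∀ a b a' b',
    Φ a b a' b' = elementaryCombination A B C a b a' b'}
  add_mem' := by
    rintro Φ Ψ ⟨A, B, C, hΦ⟩ ⟨A', B', C', hΨ⟩
    refine ⟨A + A', B + B', C + C', fun a b a' b' => ?_⟩
    rw [elementaryCombination_add, ← hΦ, ← hΨ]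
    rfl
  zero_mem' := ⟨0, 0, 0, fun a b a' b' => by simp [elementaryCombination]⟩
  smul_mem' := by
    rintro q Φ ⟨A, B, C, hΦ⟩
    let P : MvPolynomial BoundVar ℚ := MvPolynomial.C q
    refine ⟨P • A, P • B, P • C, fun a b a' b' => ?_⟩
    rw [elementaryCombination_smul, ← hΦ, aeval_C]
    rfl

variable {Φ : (Fin 3 → ℝ) → (Fin 3 → ℝ) → (Fin 3 → ℝ) → (Fin 3 → ℝ) → ℝ}
  {s s' : Fin 3 → Bool} {i j k : Fin 3} {a b a' b' : Fin 3 → ℝ}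

theorem aeval_mul_mem_elementary (P : MvPolynomial BoundVar ℚ) (hΦ : Φ ∈ elementary) :
    (fun a b a' b' => aeval (bounds a b a' b') P * Φ a b a' b') ∈ elementary := by
  obtain ⟨A, B, C, hΦ⟩ := hΦ
  exact ⟨P • A, P • B, P • C, fun a b a' b' => by simp only [elementaryCombination_smul, hΦ]⟩

/-- The `i`-th coordinate of the vertex of `Q` selected by `s`, as a polynomial in the bounds. -/
def vertexPoly (s : Fin 3 → Bool) (i : Fin 3) : MvPolynomial BoundVar ℚ :=
  X (Sum.inl (if s i then Sum.inr i else Sum.inl i))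

/-- The `i`-th coordinate of the difference of the vertices of `Q` and `Q'` selected by `s` and
`s'`, as a polynomial in the bounds. -/
def diffPoly (s s' : Fin 3 → Bool) (i : Fin 3) : MvPolynomial BoundVar ℚ :=
  vertexPoly s i - X (Sum.inr (if s' i then Sum.inr i else Sum.inl i))

theorem aeval_vertexPoly :
    aeval (bounds a b a' b') (vertexPoly s i) = vertex a b s i := by
  cases h : s i <;> simp [vertexPoly, bounds, vertex, h]

theorem aeval_diffPoly :
    aeval (bounds a b a' b') (diffPoly s s' i) = (vertex a b s - vertex a' b' s') i := by
  rw [diffPoly, map_sub, aeval_vertexPoly]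
  cases h : s' i <;> simp [bounds, vertex, h]

theorem rho_delta (π : Equiv.Perm (Fin 3)) :
    rho (delta a b a' b' s s' π) = rho (vertex a b s - vertex a' b' s') := by
  have h : IsTriple (π 0) (π 1) (π 2) :=
    ⟨π.injective.ne (by decide), π.injective.ne (by decide), π.injective.ne (by decide)⟩
  rw [rho_eq h (vertex a b s - vertex a' b' s')]
  rfl

/-- The factor `z_i` makes up for the restriction of elementary combinations to `δ₁ ≠ 0`. -/
theorem mul_elementaryTerms_mem_elementary (s s' : Fin 3 → Bool) (h : IsTriple i j k)
    (p q r : ℚ) :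
    (fun a b a' b' =>
      let z := vertex a b s - vertex a' b' s'
      z i * (p * (1 / rho z) + q * artanhTerm k z + r * arctanTerm i j k z)) ∈ elementary := by
  classical
  obtain ⟨π, rfl, rfl, rfl⟩ := h.exists_perm
  let single (c : ℚ) : Coeffs :=
    Pi.single s (Pi.single s' (Pi.single π (C c * diffPoly s s' (π 0))))
  refine ⟨single p, single q, single r, fun a b a' b' => ?_⟩
  simp only [elementaryCombination, single]
  rw [Finset.sum_eq_single s, Finset.sum_eq_single s', Finset.sum_eq_single π]
  · simp only [Pi.single_eq_same, map_mul, aeval_C, aeval_diffPoly, rho_delta]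
    have hδ (l : Fin 3) :
        delta a b a' b' s s' π l = (vertex a b s - vertex a' b' s') (π l) := rfl
    simp only [hδ, artanhTerm, arctanTerm]
    split_ifs with h0
    · simp only [Fin.isValue, Pi.sub_apply, one_div, eq_ratCast]
      ring
    · simp [not_not.mp h0]
  all_goals simp +contextual

theorem regularTerm_mem_elementary {g : (Fin 3 → ℝ) → ℝ} (hg : IsRegularTerm g)
    (s s' : Fin 3 → Bool) :
    (fun a b a' b' => g (vertex a b s - vertex a' b' s')) ∈ elementary := by
  cases hg with
  | rho =>
    have hsq {i j k : Fin 3} (h : IsTriple i j k) := aeval_mul_mem_elementary (diffPoly s s' i)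
      (mul_elementaryTerms_mem_elementary s s' h 1 0 0)
    have h : IsTriple (0 : Fin 3) 1 2 := isTriple_iff.mpr (by decide)
    convert add_mem (add_mem (hsq h) (hsq h.rotate)) (hsq h.rotate.rotate) using 1
    funext a b a' b'
    simp only [Pi.add_apply, aeval_diffPoly]
    generalize vertex a b s - vertex a' b' s' = z
    rcases (rho_nonneg z).eq_or_lt with h0 | h0
    · simp [← h0]
    · field_simp
      rw [rho_sq h]
      simp
  | artanh h =>
    obtain ⟨l, hl⟩ := exists_isTriple_of_ne h
    simpa using mul_elementaryTerms_mem_elementary s s' hl.swap 0 1 0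
  | arctan h => simpa using mul_elementaryTerms_mem_elementary s s' h 0 0 1

theorem regularSpan_comp_sub_mem_elementary {f : (Fin 3 → ℝ) → ℝ} (hf : f ∈ regularSpan)
    (s s' : Fin 3 → Bool) :
    (fun a b a' b' => f (vertex a b s - vertex a' b' s')) ∈ elementary := by
  refine polySpan_induction
    (p := fun f => (fun a b a' b' => f (vertex a b s - vertex a' b' s')) ∈ elementary)
    (fun g hg => regularTerm_mem_elementary hg s s') (zero_mem elementary) (fun _ _ => add_mem)
    (fun q _ => elementary.smul_mem q) (fun l f hf => ?_) hf
  simpa only [aeval_diffPoly] using aeval_mul_mem_elementary (diffPoly s s' l) hf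

theorem pairSpan_vertex_mem_elementary {F : (Fin 3 → ℝ) × (Fin 3 → ℝ) → ℝ}
    (hF : F ∈ pairSpan regularTerms) (s s' : Fin 3 → Bool) :
    (fun a b a' b' => F (vertex a b s, vertex a' b' s')) ∈ elementary := by
  refine polySpan_induction
    (p := fun F => (fun a b a' b' => F (vertex a b s, vertex a' b' s')) ∈ elementary) ?_
    (zero_mem elementary) (fun _ _ => add_mem) (fun q _ => elementary.smul_mem q)
    (fun l F hF => ?_) hF
  · rintro _ ⟨f, hf, rfl⟩
    exact regularSpan_comp_sub_mem_elementary hf s s'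
  · simpa only [aeval_vertexPoly] using aeval_mul_mem_elementary (vertexPoly s l) hF

theorem cornerSum_mem_elementary {F : (Fin 3 → ℝ) × (Fin 3 → ℝ) → ℝ}
    (hF : F ∈ pairSpan regularTerms) :
    (fun a b a' b' => cornerSum (fun y => cornerSum (fun x => F (x, y)) a b) a' b') ∈
      elementary := by
  have h := sum_mem (t := Finset.univ) fun s' (_ : s' ∈ Finset.univ) =>
    sum_mem (t := Finset.univ) fun s (_ : s ∈ Finset.univ) => elementary.smul_mem
      (cornerSign s' * cornerSign s : ℚ) (pairSpan_vertex_mem_elementary hF s s')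
  convert h using 1
  funext a b a' b'
  simp only [cornerSum, Finset.mul_sum, Finset.sum_apply, Pi.smul_apply, Rat.smul_def]
  push_cast
  simp only [mul_assoc]
  rfl

end Elementary

/-! ### The Newton potential and the force -/

section PotentialAndForce

theorem integrableOn_comp_sub {G E : Type*} [AddCommGroup G] [TopologicalSpace G]
    [IsTopologicalAddGroup G] [T2Space G] [SecondCountableTopology G] [MeasurableSpace G]
    [BorelSpace G] {μ : Measure G} [SFinite μ] [IsFiniteMeasureOnCompacts μ]
    [μ.IsAddRightInvariant] [NormedAddCommGroup E] [NormedSpace ℝ E] {f : G → E}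
    (hf : LocallyIntegrable f μ) {s t : Set G} (hs : IsCompact s) (ht : IsCompact t) :
    IntegrableOn (fun p : G × G => f (p.1 - p.2)) (s ×ˢ t) (μ.prod μ) := by
  have hone : Integrable (t.indicator fun _ => (1 : ℝ)) μ :=
    (integrableOn_const ht.measure_ne_top).integrable_indicator ht.measurableSet
  have hst : IsCompact (s - t) := sub_eq_add_neg s t ▸ hs.add ht.neg
  have hind : Integrable ((s - t).indicator f) μ :=
    (hf.integrableOn_isCompact hst).integrable_indicator hst.measurableSet
  refine (hone.convolution_integrand (ContinuousLinearMap.lsmul ℝ ℝ) hind).integrableOn.congr_fun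
    (fun p hp => ?_) (hs.measurableSet.prod ht.measurableSet)
  simp [indicator_of_mem hp.2, indicator_of_mem (sub_mem_sub hp.1 hp.2)]

theorem locallyIntegrable_of_abs_le_rho_rpow {f : (Fin 3 → ℝ) → ℝ} (hf : Measurable f) {α : ℝ}
    (hα : 0 ≤ α) (hα' : α < 3) (h : ∀ z, z ≠ 0 → |f z| ≤ rho z ^ (-α)) : LocallyIntegrable f := by
  refine locallyIntegrable_of_norm_le_rpow (C := 1) (α := α) (by simp) (by simpa using hα') ?_
    hf.aestronglyMeasurable
  filter_upwards [compl_mem_ae_iff.mpr (measure_singleton (0 : Fin 3 → ℝ))] with z hz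
  rw [one_mul]
  exact (h z hz).trans
    (Real.rpow_le_rpow_of_nonpos (norm_pos_iff.mpr hz) (norm_le_rho z) (neg_nonpos.mpr hα))

theorem locallyIntegrable_inv_rho : LocallyIntegrable fun z => 1 / rho z := by
  refine locallyIntegrable_of_abs_le_rho_rpow (α := 1)
    (continuous_rho.measurable.const_div 1) (by norm_num) (by norm_num) fun z _ => ?_
  rw [abs_of_nonneg (one_div_nonneg.mpr (rho_nonneg z)), Real.rpow_neg_one, one_div]

theorem locallyIntegrable_div_rho_cube (k : Fin 3) :
    LocallyIntegrable fun z => z k / rho z ^ 3 := by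
  have hmeas : Measurable fun z : Fin 3 → ℝ => z k / rho z ^ 3 :=
    (measurable_pi_apply k).div (continuous_rho.measurable.pow_const 3)
  refine locallyIntegrable_of_abs_le_rho_rpow (α := 2) hmeas (by norm_num) (by norm_num)
    fun z hz => ?_
  have hρ := rho_pos hz
  rw [abs_div, abs_of_pos (pow_pos hρ 3), Real.rpow_neg hρ.le, Real.rpow_two,
    div_le_iff₀ (pow_pos hρ 3)]
  calc |z k| ≤ rho z := abs_le_rho z k
    _ = (rho z ^ 2)⁻¹ * rho z ^ 3 := by field_simp

theorem dist3_eq (x y : Fin 3 → ℝ) : dist3 x y = rho (x - y) := by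
  simp [dist3, rho, Fin.sum_univ_three]

theorem continuous_weight (n m : Fin 3 → ℕ) :
    Continuous fun p : (Fin 3 → ℝ) × (Fin 3 → ℝ) => weight n m p.1 p.2 := by
  unfold weight
  fun_prop

theorem weight_mul_mem_pairSpan (n m : Fin 3 → ℕ) {g : (Fin 3 → ℝ) → ℝ}
    {T : Set ((Fin 3 → ℝ) → ℝ)} (hg : g ∈ pointSpan T) :
    (fun w => weight n m w.1 w.2 * g (w.1 - w.2)) ∈ pairSpan T := by
  have hy := snd_pow_mul_mem_pairSpan 0 (m 0) (snd_pow_mul_mem_pairSpan 1 (m 1)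
    (snd_pow_mul_mem_pairSpan 2 (m 2) (comp_sub_mem_pairSpan hg)))
  have hxy := coord_pow_mul_mem_polySpan 0 (n 0) (coord_pow_mul_mem_polySpan 1 (n 1)
    (coord_pow_mul_mem_polySpan 2 (n 2) hy))
  simpa only [weight, Fin.prod_univ_three, mul_assoc] using hxy

theorem exists_coeffs (n m : Fin 3 → ℕ) {k : Fin 3} {g : (Fin 3 → ℝ) → ℝ}
    (hg : pointSpan {g} ≤ primitive k (pointSpan (firstTerms k))) (hint : LocallyIntegrable g)
    (hcont : ∀ z, z ≠ 0 → ContinuousAt g z) :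
    ∃ A B C : Coeffs, ∀ a b a' b' : Fin 3 → ℝ, a ≤ b → a' ≤ b' →
      IntegrableOn (fun p : (Fin 3 → ℝ) × (Fin 3 → ℝ) => weight n m p.1 p.2 * g (p.1 - p.2))
          (Icc a b ×ˢ Icc a' b') ∧
        doubleIntegral (fun x y => weight n m x y * g (x - y)) a b a' b' =
          elementaryCombination A B C a b a' b' := by
  obtain ⟨F, hF, hFK⟩ := exists_doubleIntegral_eq
    (fun f hf => hasRegularPrimitive_of_mem_pointSpan hg (forall_eq.mpr hint)
      (forall_eq.mpr hcont) hf)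
    (weight_mul_mem_pairSpan n m (subset_polySpan (mem_singleton g)))
  obtain ⟨A, B, C, hABC⟩ := cornerSum_mem_elementary hF
  refine ⟨A, B, C, fun a b a' b' hab hab' => ⟨?_, (hFK a b a' b' hab hab').trans (hABC ..)⟩⟩
  exact (integrableOn_comp_sub hint isCompact_Icc isCompact_Icc).continuousOn_mul
    (continuous_weight n m).continuousOn (isCompact_Icc.prod isCompact_Icc)

theorem exists_potential_coeffs (n m : Fin 3 → ℕ) :
    ∃ A B C : Coeffs, ∀ a b a' b' : Fin 3 → ℝ, a ≤ b → a' ≤ b' →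
      IntegrableOn (fun p : (Fin 3 → ℝ) × (Fin 3 → ℝ) => potentialKernel n m p.1 p.2)
          (Icc a b ×ˢ Icc a' b') ∧
        potential n m a b a' b' = elementaryCombination A B C a b a' b' := by
  have hK : potentialKernel n m = fun x y => weight n m x y * (1 / rho (x - y)) := by
    funext x y
    rw [potentialKernel, dist3_eq, mul_one_div]
  unfold potential
  rw [hK]
  exact exists_coeffs n m (pointSpan_inv_rho_le_primitive 0) locallyIntegrable_inv_rho
    fun z hz => continuousAt_const.div continuous_rho.continuousAt (rho_pos hz).ne'

theorem exists_force_coeffs (n m : Fin 3 → ℕ) (j : Fin 3) :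
    ∃ A B C : Coeffs, ∀ a b a' b' : Fin 3 → ℝ, a ≤ b → a' ≤ b' →
      IntegrableOn (fun p : (Fin 3 → ℝ) × (Fin 3 → ℝ) => forceKernel n m j p.1 p.2)
          (Icc a b ×ˢ Icc a' b') ∧
        force n m j a b a' b' = elementaryCombination A B C a b a' b' := by
  have hK : forceKernel n m j =
      fun x y => weight n m x y * ((x - y) j / rho (x - y) ^ 3) := by
    funext x y
    rw [forceKernel, dist3_eq, Pi.sub_apply]
    ring
  unfold force
  rw [hK]
  exact exists_coeffs n m (pointSpan_div_rho_cube_le_primitive j)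
    (locallyIntegrable_div_rho_cube j) fun z hz => (continuous_apply j).continuousAt.div
      (continuous_rho.continuousAt.pow 3) (pow_pos (rho_pos hz) 3).ne'

end PotentialAndForce

end

end Cuboid

theorem mainTheorem1 (n m : Fin 3 → ℕ) :
    (∃ A B C : Cuboid.Coeffs, ∀ a b a' b' : Fin 3 → ℝ, a ≤ b → a' ≤ b' →
      IntegrableOn (fun p : (Fin 3 → ℝ) × (Fin 3 → ℝ) => Cuboid.potentialKernel n m p.1 p.2)
          (Set.Icc a b ×ˢ Set.Icc a' b') ∧
        Cuboid.potential n m a b a' b' = Cuboid.elementaryCombination A B C a b a' b') ∧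
    ∀ j : Fin 3, ∃ A B C : Cuboid.Coeffs, ∀ a b a' b' : Fin 3 → ℝ, a ≤ b → a' ≤ b' →
      IntegrableOn (fun p : (Fin 3 → ℝ) × (Fin 3 → ℝ) => Cuboid.forceKernel n m j p.1 p.2)
          (Set.Icc a b ×ˢ Set.Icc a' b') ∧
        Cuboid.force n m j a b a' b' = Cuboid.elementaryCombination A B C a b a' b' :=
  ⟨Cuboid.exists_potential_coeffs n m, Cuboid.exists_force_coeffs n m⟩
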